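/- Let $N\in\mathbb N$, let $\Omega\subset\mathbb{R}^N$ be a bounded domain (open, connected, non-empty; no regularity of $\partial\Omega$ is assumed), and let $\mathcal{O}\subset\mathbb{R}^N$ be an open set with $\overline\Omega\subset\mathcal{O}$. Let $\mathcal{S}_N$ be the space of real symmetric $N\times N$ matrices with its usual partial order, and let $F:\mathcal{O}\times\mathbb{R}\times\mathbb{R}^N\times\mathcal{S}_N\to\mathbb{R}$ be a continuous function such that: (H1) $F(x,r,p,X+Y)-F(x,r,p,X)\le 0$ for all $(x,r,p)\in\mathcal{O}\times\mathbb{R}\times\mathbb{R}^N$ and $X,Y\in\mathcal{S}_N$ with $Y\ge 0$; (H2) for some $\alpha>0$, $F(x,\tau r,\tau p,\tau X)=\tau^\alpha F(x,r,p,X)$ for all $(x,r,p,X)\in\mathcal{O}\times\mathbb{R}\times\mathbb{R}^N\times\mathcal{S}_N$ and $\tau\ge 0$; (H3) $r\mapsto F(x,r,p,X)$ is continuous, uniformly with respect to $(x,p,X)$, i.e. for every $r\in\mathbb{R}$ and $\varepsilon>0$ there is $\delta>0$ such that $|F(x,s,p,X)-F(x,r,p,X)|<\varepsilon$ whenever $|s-r|<\delta$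 and $(x,p,X)\in\mathcal{O}\times\mathbb{R}^N\times\mathcal{S}_N$; (H4) for every $R>0$ there is $\omega\in C([0,+\infty))$ with $\omega(0)=0$ such that, whenever $X,Y\in\mathcal{S}_N$ and $\sigma>0$ satisfy $$-3\sigma\begin{pmatrix} I&0\\0&I\end{pmatrix}\le\begin{pmatrix} X&0\\0&-Y\end{pmatrix}\le 3\sigma\begin{pmatrix} I&-I\\-I&I\end{pmatrix},$$ one has $F(y,r,\sigma(x-y),Y)-F(x,r,\sigma(x-y),X)\le\omega(\sigma|x-y|^2+|x-y|)$ for all $x,y\in\mathcal{O}$ and $|r|\le R$. An upper semicontinuous function $u:\overline\Omega\to\mathbb{R}$ is a viscosity subsolution of the Dirichlet problem $F(x,u,Du,D^2u)=0$ in $\Omega$, $u=0$ on $\partial\Omega$, if for every $\varphi\in C^2(\mathbb{R}^N)$ and every $\xi\in\overline\Omega$ with $(u-\varphi)(\xi)=\max_{\overline\Omega}(u-\varphi)$ one has $$F(\xi,u(\xi),D\varphi(\xi),D^2\varphi(\xi))\le 0\quad\text{if }\xi\in\Omega,$$ $$\min\big[u(\xi),\,F(\xi,u(\xi),D\varphi(\xi),D^2\varphi(\xi))\big]\le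 0\quad\text{if }\xi\in\partial\Omega.$$ One says that $F$ satisfies the Maximum Principle (MP) in $\Omega$ if every such subsolution satisfies $u\le 0$ in $\overline\Omega$. Let $\mu_1(F,\Omega)\in[-\infty,+\infty]$ be the supremum of all $\lambda\in\mathbb{R}$ for which there exist an open set $\Omega'$ with $\overline\Omega\subset\Omega'\subset\mathcal{O}$ and a lower semicontinuous function $\phi:\Omega'\to(0,+\infty)$ satisfying $F(x,\phi,D\phi,D^2\phi)-\lambda\phi^\alpha\ge 0$ in $\Omega'$ in the viscosity sense, that is, $F(\xi,\phi(\xi),D\psi(\xi),D^2\psi(\xi))-\lambda\phi(\xi)^\alpha\ge 0$ whenever $\psi\in C^2(\mathbb{R}^N)$ and $\phi-\psi$ has a local minimum at $\xi\in\Omega'$. Then $F$ satisfies MP in $\Omega$ if and only if $\mu_1(F,\Omega)>0$. -/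

import Mathlib

namespace DegenerateMP

/-- `ℝᴺ` with its Euclidean norm. -/
abbrev Space (N : ℕ) : Type := EuclideanSpace ℝ (Fin N)

/-- Real `N × N` matrices; the symmetric ones are singled out by `Matrix.IsSymm`. -/
abbrev Mat (N : ℕ) : Type := Matrix (Fin N) (Fin N) ℝ

/-- The nonlinearity `(x, r, p, X) ↦ F(x, r, p, X)` of a second order operator. Only its values at
`x` in the open set where the operator lives and at symmetric `X` are ever constrained or used. -/
abbrev Operator (N : ℕ) : Type := Space N → ℝ → Space N → Mat N → ℝ

/-- The Hessian matrix `D²φ(x)` in the standard basis. -/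
noncomputable def hessian {N : ℕ} (φ : Space N → ℝ) (x : Space N) : Mat N :=
  Matrix.of fun i j =>
    fderiv ℝ (fderiv ℝ φ) x (EuclideanSpace.single i 1) (EuclideanSpace.single j 1)

/-- `F` is (jointly) continuous on `O × ℝ × ℝᴺ × S_N`. -/
def IsContinuousOperator {N : ℕ} (O : Set (Space N)) (F : Operator N) : Prop :=
  ContinuousOn (fun q : Space N × ℝ × Space N × Mat N => F q.1 q.2.1 q.2.2.1 q.2.2.2)
    {q | q.1 ∈ O ∧ q.2.2.2.IsSymm}

/-- Degenerate ellipticity: `F(x,r,p,X+Y) - F(x,r,p,X) ≤ 0` for symmetric `X` and `Y ≥ 0`. -/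
def IsDegenerateElliptic {N : ℕ} (O : Set (Space N)) (F : Operator N) : Prop :=
  ∀ x ∈ O, ∀ (r : ℝ) (p : Space N) (X Y : Mat N), X.IsSymm → Y.PosSemidef →
    F x r p (X + Y) - F x r p X ≤ 0

/-- Positive homogeneity of degree `α` in `(r, p, X)`. -/
def IsPosHomogeneous {N : ℕ} (O : Set (Space N)) (F : Operator N) (α : ℝ) : Prop :=
  ∀ x ∈ O, ∀ (r : ℝ) (p : Space N) (X : Mat N), X.IsSymm → ∀ τ : ℝ, 0 ≤ τ →
    F x (τ * r) (τ • p) (τ • X) = τ ^ α * F x r p X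

/-- `r ↦ F(x,r,p,X)` is continuous (at every `r`), uniformly with respect to `(x,p,X)`. -/
def IsContinuousInValueUniformly {N : ℕ} (O : Set (Space N)) (F : Operator N) : Prop :=
  ∀ r : ℝ, ∀ ε > 0, ∃ δ > 0, ∀ s : ℝ, |s - r| < δ →
    ∀ x ∈ O, ∀ (p : Space N) (X : Mat N), X.IsSymm → |F x s p X - F x r p X| < ε

/-- The two-sided matrix inequality
`-3σ (I 0; 0 I) ≤ (X 0; 0 -Y) ≤ 3σ (I -I; -I I)` in the Loewner order. -/
def DoublingIneq {N : ℕ} (σ : ℝ) (X Y : Mat N) : Prop :=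
  (Matrix.fromBlocks X 0 0 (-Y) - (-(3 * σ)) • Matrix.fromBlocks 1 0 0 1).PosSemidef ∧
  ((3 * σ) • Matrix.fromBlocks 1 (-1) (-1) 1 - Matrix.fromBlocks X 0 0 (-Y)).PosSemidef

/-- The Crandall–Ishii–Lions structure condition. -/
def StructureCondition {N : ℕ} (O : Set (Space N)) (F : Operator N) : Prop :=
  ∀ R > 0, ∃ ω : ℝ → ℝ, ContinuousOn ω (Set.Ici 0) ∧ ω 0 = 0 ∧
    ∀ X Y : Mat N, X.IsSymm → Y.IsSymm → ∀ σ > 0, DoublingIneq σ X Y →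
      ∀ x ∈ O, ∀ y ∈ O, ∀ r : ℝ, |r| ≤ R →
        F y r (σ • (x - y)) Y - F x r (σ • (x - y)) X ≤ ω (σ * ‖x - y‖ ^ 2 + ‖x - y‖)

/-- `u` is a viscosity subsolution of `F[u] = 0` in `Ω`, `u = 0` on `∂Ω`, the boundary condition
being understood in the relaxed viscosity sense: at a boundary point either `u ≤ 0` or the
differential inequality holds. As `closure Ω` is compact in the theorem, `C²` functions on a
neighbourhood of it and restrictions of `C²` functions on `ℝᴺ` are the same test functions. -/
def IsDirichletSubsolution {N : ℕ} (F : Operator N) (Ω : Set (Space N)) (u : Space N → ℝ) : Prop :=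
  ∀ φ : Space N → ℝ, ContDiff ℝ 2 φ → ∀ ξ ∈ closure Ω,
    IsMaxOn (fun x => u x - φ x) (closure Ω) ξ →
      (ξ ∈ Ω → F ξ (u ξ) (gradient φ ξ) (hessian φ ξ) ≤ 0) ∧
      (ξ ∈ frontier Ω → min (u ξ) (F ξ (u ξ) (gradient φ ξ) (hessian φ ξ)) ≤ 0)

/-- The Maximum Principle: every upper semicontinuous viscosity subsolution of the Dirichlet problem
is nonpositive on `closure Ω`. -/
def MaximumPrinciple {N : ℕ} (F : Operator N) (Ω : Set (Space N)) : Prop :=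
  ∀ u : Space N → ℝ, UpperSemicontinuousOn u (closure Ω) → IsDirichletSubsolution F Ω u →
    ∀ x ∈ closure Ω, u x ≤ 0

/-- `φ` is a viscosity supersolution of `G[φ] ≥ 0` in the open set `U`. -/
def IsSupersolution {N : ℕ} (G : Operator N) (U : Set (Space N)) (φ : Space N → ℝ) : Prop :=
  ∀ ψ : Space N → ℝ, ContDiff ℝ 2 ψ → ∀ ξ ∈ U, IsLocalMin (fun x => φ x - ψ x) ξ →
    0 ≤ G ξ (φ ξ) (gradient ψ ξ) (hessian ψ ξ)

/-- The generalized principal eigenvalue `μ₁(F, Ω)`, an extended real number: the supremum of the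
`l` for which there are an open `Ω'` with `closure Ω ⊆ Ω' ⊆ O` and a positive lower semicontinuous
viscosity supersolution of `F[φ] - l φ^α ≥ 0` in `Ω'`. -/
noncomputable def mu1 {N : ℕ} (O : Set (Space N)) (F : Operator N) (α : ℝ) (Ω : Set (Space N)) :
    EReal :=
  sSup {m : EReal | ∃ l : ℝ, m = (l : EReal) ∧
    ∃ Ω' : Set (Space N), IsOpen Ω' ∧ closure Ω ⊆ Ω' ∧ Ω' ⊆ O ∧
      ∃ φ : Space N → ℝ, LowerSemicontinuousOn φ Ω' ∧ (∀ x ∈ Ω', 0 < φ x) ∧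
        IsSupersolution (fun x r p X => F x r p X - l * r ^ α) Ω' φ}

end DegenerateMP

/-!
If `μ₁ > 0`, let `φ > 0` be a supersolution of `F[φ] ≥ l φ ^ α` with `l > 0` near `closure Ω`. A
subsolution `u` that is positive somewhere lies below a least multiple `τ φ`, and touches it. At the
contact point doubling variables and the theorem on sums play the inequality for `u` against
`F[τ φ] ≥ l (τ φ) ^ α > 0`, which is a contradiction. The theorem on sums is proved by regularizing
with sup-convolutions followed by inf-convolutions, which have Lipschitz gradients, and using
Jensen's lemma to find many points of second order differentiability near a maximum.

If `μ₁ ≤ 0`, let `l` decrease to `0`. On a small compact neighbourhood of `closure Ω`, consider the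
greatest subsolution of `F[w] = l w ^ α` above the obstacle `l` and below `1`. It attains the
value `1`, since otherwise Perron's method makes its lower envelope a positive supersolution, so
that `μ₁ ≥ l`. As `l → 0` and the neighbourhoods shrink, the relaxed upper limit of these functions
is a subsolution of the Dirichlet problem that takes the value `1`, so the maximum principle fails.
-/

namespace DegenerateMP

open Filter Topology Set
open scoped RealInnerProductSpace Matrix

section Calculus

variable {E : Type*} [NormedAddCommGroup E] [NormedSpace ℝ E] {f : E → ℝ} {f' : E → E →L[ℝ] ℝ}
  {f'' : E →L[ℝ] E →L[ℝ] ℝ} {x : E}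

lemma hasDerivAt_comp_line (hf : ∀ y, HasFDerivAt f (f' y) y) (x h : E) (t : ℝ) :
    HasDerivAt (fun t : ℝ => f (x + t • h)) (f' (x + t • h) h) t := by
  have hline : HasDerivAt (fun t : ℝ => x + t • h) h t := by
    simpa using ((hasDerivAt_id t).smul_const h).const_add x
  exact (hf (x + t • h)).comp_hasDerivAt t hline

open Asymptotics in
lemma isLittleO_second_order_expansion (hf : ∀ y, HasFDerivAt f (f' y) y)
    (hf' : HasFDerivAt f' f'' x) :
    (fun h => f (x + h) - f x - f' x h - 1 / 2 * f'' h h) =o[𝓝 0] fun h => ‖h‖ ^ 2 := by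
  refine isLittleO_iff.2 fun ε hε => ?_
  obtain ⟨r, hr, hball⟩ := Metric.eventually_nhds_iff_ball.1
    ((hasFDerivAt_iff_isLittleO_nhds_zero.1 hf').bound hε)
  filter_upwards [Metric.ball_mem_nhds (0 : E) hr] with h hh
  have hder : ∀ t ∈ Icc (0 : ℝ) 1, HasDerivWithinAt
      (fun t : ℝ => f (x + t • h) - t * f' x h - 1 / 2 * t ^ 2 * f'' h h)
      (f' (x + t • h) h - f' x h - t * f'' h h) (Icc 0 1) t := fun t _ =>
    ((((hasDerivAt_comp_line hf x h t).sub ((hasDerivAt_id t).mul_const (f' x h))).sub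
      ((((hasDerivAt_id t).pow 2).const_mul (1 / 2 : ℝ)).mul_const (f'' h h))).congr_deriv
        (by simp)).hasDerivWithinAt
  have hbound : ∀ t ∈ Icc (0 : ℝ) 1,
      ‖f' (x + t • h) h - f' x h - t * f'' h h‖ ≤ ε * ‖h‖ ^ 2 := by
    intro t ht
    have hth : ‖t • h‖ ≤ ‖h‖ := by
      rw [norm_smul, Real.norm_of_nonneg ht.1]
      exact mul_le_of_le_one_left (norm_nonneg h) ht.2
    have hmem : t • h ∈ Metric.ball (0 : E) r :=
      mem_ball_zero_iff.2 (hth.trans_lt (mem_ball_zero_iff.1 hh))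
    calc ‖f' (x + t • h) h - f' x h - t * f'' h h‖
        = ‖(f' (x + t • h) - f' x - f'' (t • h)) h‖ := by simp
      _ ≤ ‖f' (x + t • h) - f' x - f'' (t • h)‖ * ‖h‖ := ContinuousLinearMap.le_opNorm _ _
      _ ≤ ε * ‖t • h‖ * ‖h‖ := by gcongr; exact hball _ hmem
      _ ≤ ε * ‖h‖ * ‖h‖ := by gcongr
      _ = ε * ‖h‖ ^ 2 := by ring
  have := (convex_Icc (0 : ℝ) 1).norm_image_sub_le_of_norm_hasDerivWithin_le hder hbound
    (left_mem_Icc.2 zero_le_one) (right_mem_Icc.2 zero_le_one)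
  rw [norm_pow, norm_norm]
  convert this using 1
  · congr 1
    simp only [one_smul, one_mul, one_pow, mul_one, zero_smul, add_zero, zero_mul, sub_zero,
      ne_eq, OfNat.ofNat_ne_zero, not_false_eq_true, zero_pow, mul_zero]
    ring
  · simp

lemma tendsto_second_difference_quotient (hf : ∀ y, HasFDerivAt f (f' y) y)
    (hf' : HasFDerivAt f' f'' x) (h : E) :
    Tendsto (fun t : ℝ => (f (x + t • h) - f x - t * f' x h) / t ^ 2) (𝓝[≠] 0)
      (𝓝 (1 / 2 * f'' h h)) := by
  have hline : Tendsto (fun t : ℝ => t • h) (𝓝[≠] 0) (𝓝 0) := by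
    have : Continuous fun t : ℝ => t • h := by fun_prop
    simpa using (this.tendsto 0).mono_left nhdsWithin_le_nhds
  have hO : (fun t : ℝ => ‖t • h‖ ^ 2) =O[𝓝[≠] 0] fun t => t ^ 2 :=
    .of_bound (‖h‖ ^ 2) (.of_forall fun t => by simp [norm_smul, mul_pow, mul_comm])
  have hlim := (((isLittleO_second_order_expansion hf hf').comp_tendsto hline).trans_isBigO
    hO).tendsto_div_nhds_zero.add_const (1 / 2 * f'' h h)
  rw [zero_add] at hlim
  refine hlim.congr' ?_
  filter_upwards [self_mem_nhdsWithin] with t (ht : t ≠ 0)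
  simp only [Function.comp_apply, map_smul, smul_eq_mul, _root_.smul_apply]
  field_simp
  ring

lemma second_deriv_nonneg_of_isLocalMin (hf : ∀ y, HasFDerivAt f (f' y) y)
    (hf' : HasFDerivAt f' f'' x) (hmin : IsLocalMin f x) (h : E) : 0 ≤ f'' h h := by
  have hline : Tendsto (fun t : ℝ => x + t • h) (𝓝[≠] 0) (𝓝 x) := by
    have : Continuous fun t : ℝ => x + t • h := by fun_prop
    simpa using (this.tendsto 0).mono_left nhdsWithin_le_nhds
  have hge : ∀ᶠ t : ℝ in 𝓝[≠] 0, 0 ≤ (f (x + t • h) - f x - t * f' x h) / t ^ 2 := by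
    filter_upwards [hline.eventually hmin] with t ht
    rw [hmin.hasFDerivAt_eq_zero (hf x), _root_.zero_apply, mul_zero, sub_zero]
    exact div_nonneg (sub_nonneg.2 ht) (sq_nonneg t)
  linarith [ge_of_tendsto (tendsto_second_difference_quotient hf hf' h) hge]

end Calculus

section GradientField

open InnerProductSpace

variable {E : Type*} [NormedAddCommGroup E] [InnerProductSpace ℝ E] [CompleteSpace E]
  {f g : E → ℝ} {P : E → E} {T : E →L[ℝ] E} {x : E}

lemma hasGradientAt_add {p q : E} (hf : HasGradientAt f p x) (hg : HasGradientAt g q x) :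
    HasGradientAt (fun y => f y + g y) (p + q) x := by
  simpa only [hasGradientAt_iff_hasFDerivAt, map_add] using hf.hasFDerivAt.fun_add hg.hasFDerivAt

lemma hasGradientAt_sub {p q : E} (hf : HasGradientAt f p x) (hg : HasGradientAt g q x) :
    HasGradientAt (fun y => f y - g y) (p - q) x := by
  simpa only [hasGradientAt_iff_hasFDerivAt, map_sub] using hf.hasFDerivAt.fun_sub hg.hasFDerivAt

lemma hasGradientAt_neg {p : E} (hf : HasGradientAt f p x) :
    HasGradientAt (fun y => -f y) (-p) x := by
  simpa only [hasGradientAt_iff_hasFDerivAt, map_neg] using hf.hasFDerivAt.fun_neg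

lemma hasGradientAt_inner_sub (q a x : E) : HasGradientAt (fun y => ⟪q, y - a⟫) q x :=
  hasGradientAt_iff_hasFDerivAt.2
    ((innerSL ℝ q).hasFDerivAt.comp x ((hasFDerivAt_id x).sub_const a))

lemma hasGradientAt_norm_sub_sq (c : ℝ) (a x : E) :
    HasGradientAt (fun y => c / 2 * ‖y - a‖ ^ 2) (c • (x - a)) x := by
  rw [hasGradientAt_iff_hasFDerivAt]
  refine ((((hasFDerivAt_id x).sub_const a).norm_sq).const_mul (c / 2)).congr_fderiv ?_
  ext h
  simp only [_root_.smul_apply, ContinuousLinearMap.comp_apply, innerSL_apply_apply, id_eq,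
    ContinuousLinearMap.id_apply, toDual_apply_apply, inner_smul_left, smul_eq_mul, nsmul_eq_mul,
    Nat.cast_ofNat, conj_trivial]
  ring

lemma hasFDerivAt_toDual_comp (hP : HasFDerivAt P T x) :
    HasFDerivAt (fun y => (toDual ℝ E (P y) : E →L[ℝ] ℝ))
      ((innerSL ℝ : E →L[ℝ] E →L[ℝ] ℝ) ∘L T) x :=
  (innerSL ℝ : E →L[ℝ] E →L[ℝ] ℝ).hasFDerivAt.comp x hP

lemma isSelfAdjoint_of_hasGradientAt (hf : ∀ y, HasGradientAt f (P y) y)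
    (hP : HasFDerivAt P T x) : IsSelfAdjoint T := by
  refine ContinuousLinearMap.isSelfAdjoint_iff_isSymmetric.2 fun h k => ?_
  rw [real_inner_comm _ h]
  exact second_derivative_symmetric (fun y => (hf y).hasFDerivAt) (hasFDerivAt_toDual_comp hP) h k

lemma tendsto_second_difference_quotient_of_hasGradientAt (hf : ∀ y, HasGradientAt f (P y) y)
    (hP : HasFDerivAt P T x) (h : E) :
    Tendsto (fun t : ℝ => (f (x + t • h) - f x - t * ⟪P x, h⟫) / t ^ 2) (𝓝[≠] 0)
      (𝓝 (1 / 2 * ⟪T h, h⟫)) :=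
  tendsto_second_difference_quotient (fun y => (hf y).hasFDerivAt) (hasFDerivAt_toDual_comp hP) h

lemma inner_nonneg_of_isLocalMin (hf : ∀ y, HasGradientAt f (P y) y) (hP : HasFDerivAt P T x)
    (hmin : IsLocalMin f x) (h : E) : 0 ≤ ⟪T h, h⟫ :=
  second_deriv_nonneg_of_isLocalMin (fun y => (hf y).hasFDerivAt) (hasFDerivAt_toDual_comp hP)
    hmin h

lemma eq_zero_of_isLocalMin {p : E} (hf : HasGradientAt f p x) (hmin : IsLocalMin f x) : p = 0 :=
  (toDual ℝ E).map_eq_zero_iff.1 (hmin.hasFDerivAt_eq_zero hf.hasFDerivAt)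

end GradientField

section Jensen

open MeasureTheory Module

-- By Rademacher's theorem, `Γ` maps the points of nondifferentiability of `f` to a null set.
lemma exists_forall_preimage_differentiableAt {V W : Type*} [NormedAddCommGroup V]
    [NormedSpace ℝ V] [FiniteDimensional ℝ V] [NormedAddCommGroup W] [NormedSpace ℝ W]
    [FiniteDimensional ℝ W] {Γ : V → V} {f : V → W} {C C' : NNReal}
    (hΓ : LipschitzWith C Γ) (hf : LipschitzWith C' f) {r : ℝ} (hr : 0 < r) :
    ∃ q ∈ Metric.ball (0 : V) r, ∀ w, Γ w = q → DifferentiableAt ℝ f w := by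
  let _ : MeasurableSpace V := borel V
  have : BorelSpace V := ⟨rfl⟩
  set μ : Measure V := Measure.hausdorffMeasure (finrank ℝ V : ℝ) with hμ
  have : μ.IsAddHaarMeasure := isAddHaarMeasure_hausdorffMeasure
  have hnull : μ {w | ¬ DifferentiableAt ℝ f w} = 0 := hf.ae_differentiableAt (μ := μ)
  have himage : μ (Γ '' {w | ¬ DifferentiableAt ℝ f w}) = 0 := by
    have := hΓ.hausdorffMeasure_image_le (d := (finrank ℝ V : ℝ)) (Nat.cast_nonneg _)
      {w | ¬ DifferentiableAt ℝ f w}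
    rwa [← hμ, hnull, mul_zero, nonpos_iff_eq_zero] at this
  obtain ⟨q, hq, hq'⟩ := not_subset.1 fun hsub : Metric.ball (0 : V) r ⊆ Γ '' _ =>
    (Metric.measure_ball_pos μ 0 hr).ne' (measure_mono_null hsub himage)
  exact ⟨q, hq, fun w hw => by_contra fun hnd => hq' ⟨w, hnd, hw⟩⟩

variable {V : Type*} [NormedAddCommGroup V] [InnerProductSpace ℝ V] [FiniteDimensional ℝ V]

lemma exists_max_sub_quadratic_sub_inner {Φ : V → ℝ} (hΦ : Continuous Φ) {w₀ : V}
    (hmax : ∀ w, Φ w ≤ Φ w₀) {δ : ℝ} (hδ : 0 < δ) (q : V) :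
    ∃ w, ‖w - w₀‖ ≤ 2 * ‖q‖ / δ ∧
      ∀ y, Φ y - δ / 2 * ‖y - w₀‖ ^ 2 - ⟪q, y - w₀⟫ ≤
        Φ w - δ / 2 * ‖w - w₀‖ ^ 2 - ⟪q, w - w₀⟫ := by
  set Ψ : V → ℝ := fun y => Φ y - δ / 2 * ‖y - w₀‖ ^ 2 - ⟪q, y - w₀⟫ with hΨ
  obtain ⟨w, hw, hwmax⟩ := (isCompact_closedBall w₀ (2 * ‖q‖ / δ)).exists_isMaxOn
    ⟨w₀, Metric.mem_closedBall_self (by positivity)⟩ (f := Ψ) (by fun_prop)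
  have hw₀ : Φ w₀ ≤ Ψ w := by
    simpa [hΨ] using hwmax (Metric.mem_closedBall_self (x := w₀) (by positivity))
  refine ⟨w, by rwa [← dist_eq_norm], fun y => ?_⟩
  by_cases hy : dist y w₀ ≤ 2 * ‖q‖ / δ
  · exact hwmax hy
  · rw [not_le, dist_eq_norm, div_lt_iff₀ hδ] at hy
    have hinner := neg_le_of_abs_le (abs_real_inner_le_norm q (y - w₀))
    have hq : ‖q‖ * ‖y - w₀‖ ≤ δ / 2 * ‖y - w₀‖ ^ 2 := by nlinarith [norm_nonneg (y - w₀)]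
    refine le_trans ?_ hw₀
    linarith [hmax y]

theorem exists_almost_max_twice_differentiable {Φ : V → ℝ} {P : V → V} {C : NNReal}
    (hΦ : ∀ w, HasGradientAt Φ (P w) w) (hP : LipschitzWith C P) {w₀ : V}
    (hmax : ∀ w, Φ w ≤ Φ w₀) {δ : ℝ} (hδ : 0 < δ) :
    ∃ (w : V) (T : V →L[ℝ] V), ‖w - w₀‖ ≤ δ ∧ ‖P w‖ ≤ δ ∧ HasFDerivAt P T w ∧
      ∀ h, ⟪T h, h⟫ ≤ δ * ‖h‖ ^ 2 := by
  obtain ⟨q, hq, hdiff⟩ := exists_forall_preimage_differentiableAt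
    (hP.sub ((lipschitzWith_smul δ).comp (LipschitzWith.id.sub (.const w₀)))) hP
    (show 0 < min (δ ^ 2 / 2) (δ / 3) by positivity)
  rw [mem_ball_zero_iff, lt_min_iff] at hq
  obtain ⟨w, hw, hwmax⟩ := exists_max_sub_quadratic_sub_inner
    (continuous_iff_continuousAt.2 fun w => (hΦ w).continuousAt) hmax hδ q
  set Ψ : V → ℝ := fun y => -(Φ y - δ / 2 * ‖y - w₀‖ ^ 2 - ⟪q, y - w₀⟫)
  have hΨ : ∀ y, HasGradientAt Ψ (-(P y - δ • (y - w₀) - q)) y := fun y =>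
    hasGradientAt_neg <| hasGradientAt_sub
      (hasGradientAt_sub (hΦ y) (hasGradientAt_norm_sub_sq δ w₀ y))
      (hasGradientAt_inner_sub q w₀ y)
  have hmin : IsLocalMin Ψ w := .of_forall fun y => neg_le_neg (hwmax y)
  have hcrit : P w - δ • (w - w₀) = q := by
    simpa [sub_eq_zero, eq_comm] using eq_zero_of_isLocalMin (hΨ w) hmin
  obtain ⟨T, hT⟩ := hdiff w hcrit
  refine ⟨w, T, hw.trans ?_, ?_, hT, fun h => ?_⟩
  · rw [div_le_iff₀ hδ]
    nlinarith
  · have hδw : δ * ‖w - w₀‖ ≤ 2 * ‖q‖ := by rwa [le_div_iff₀ hδ, mul_comm] at hw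
    calc ‖P w‖ = ‖q + δ • (w - w₀)‖ := by rw [← hcrit, sub_add_cancel]
      _ ≤ ‖q‖ + δ * ‖w - w₀‖ := by
        simpa [norm_smul, abs_of_pos hδ] using norm_add_le q (δ • (w - w₀))
      _ ≤ δ := by linarith
  · have hder := ((hT.sub (((hasFDerivAt_id w).sub_const w₀).const_smul δ)).sub_const q).neg
    have := inner_nonneg_of_isLocalMin hΨ hder hmin h
    simp only [_root_.neg_apply, _root_.sub_apply, _root_.smul_apply, ContinuousLinearMap.id_apply,
      inner_neg_left, inner_sub_left, real_inner_smul_left, real_inner_self_eq_norm_sq] at this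
    linarith

end Jensen

section InfConvolution

variable {E : Type*} [NormedAddCommGroup E] {g k : ℝ}

/-- `U` is the inf-convolution of `v` with the kernel `k / 2 * ‖·‖ ^ 2`, and `z x` is a point where
the infimum defining `U x` is attained. -/
structure IsInfConvolution (k : ℝ) (v U : E → ℝ) (z : E → E) : Prop where
  eq : ∀ x, U x = v (z x) + k / 2 * ‖x - z x‖ ^ 2
  le : ∀ x y, U x ≤ v y + k / 2 * ‖x - y‖ ^ 2

lemma IsInfConvolution.le_self {v U : E → ℝ} {z : E → E} (h : IsInfConvolution k v U z) (x : E) :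
    U x ≤ v x := by
  simpa using h.le x x

lemma isLocalMin_add_paraboloid {U : E → ℝ} {G c : ℝ} {x ξ : E}
    (hle : ∀ y, c - G / 2 * ‖y - ξ‖ ^ 2 ≤ U y) (heq : U x = c - G / 2 * ‖x - ξ‖ ^ 2) :
    IsLocalMin (fun y => U y + G / 2 * ‖y - ξ‖ ^ 2) x :=
  .of_forall fun y => by linarith [hle y]

variable [InnerProductSpace ℝ E]

lemma norm_convexComb_sub_sq {a b : ℝ} (hab : a + b = 1) (x y ξ : E) :
    ‖a • x + b • y - ξ‖ ^ 2 = a * ‖x - ξ‖ ^ 2 + b * ‖y - ξ‖ ^ 2 - a * b * ‖x - y‖ ^ 2 := by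
  obtain rfl : a = 1 - b := eq_sub_of_add_eq hab
  rw [show (1 - b) • x + b • y - ξ = (1 - b) • (x - ξ) + b • (y - ξ) by module,
    ← sub_sub_sub_cancel_right x y ξ, norm_add_sq_real, norm_sub_sq_real (x - ξ)]
  simp only [norm_smul, Real.norm_eq_abs, mul_pow, sq_abs, inner_smul_left, inner_smul_right,
    conj_trivial]
  ring

-- The curvature `g * k / (k - g)` satisfies `1 / g = 1 / (g * k / (k - g)) + 1 / k`.
lemma complete_square (hkg : k - g ≠ 0) (x y ξ : E) :
    k / 2 * ‖x - y‖ ^ 2 - g / 2 * ‖y - ξ‖ ^ 2 =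
      (k - g) / 2 * ‖y - (x + (g / (k - g)) • (x - ξ))‖ ^ 2 -
        g * k / (k - g) / 2 * ‖x - ξ‖ ^ 2 := by
  rw [show y - (x + (g / (k - g)) • (x - ξ)) = -(x - y) - (g / (k - g)) • (x - ξ) by module,
    show y - ξ = (x - ξ) - (x - y) by module, norm_sub_sq_real (-(x - y)), norm_sub_sq_real (x - ξ)]
  simp only [norm_smul, Real.norm_eq_abs, mul_pow, sq_abs, inner_neg_left, norm_neg,
    inner_smul_right, real_inner_comm (x - y)]
  field_simp
  ring

lemma exists_isInfConvolution [ProperSpace E] {v : E → ℝ} (hv : LowerSemicontinuous v)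
    (hgk : g < k) {c : ℝ} {ξ : E} (hle : ∀ y, c - g / 2 * ‖y - ξ‖ ^ 2 ≤ v y) :
    ∃ U z, IsInfConvolution k v U z := by
  suffices hmin : ∀ x, ∃ z, ∀ y, v z + k / 2 * ‖x - z‖ ^ 2 ≤ v y + k / 2 * ‖x - y‖ ^ 2 by
    choose z hz using hmin
    exact ⟨_, z, fun x => rfl, hz⟩
  intro x
  have hkg : 0 < k - g := sub_pos.2 hgk
  set m := x + (g / (k - g)) • (x - ξ)
  have hcoercive : Tendsto (fun y => c + ((k - g) / 2 * ‖y - m‖ ^ 2 -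
      g * k / (k - g) / 2 * ‖x - ξ‖ ^ 2)) (cocompact E) atTop := by
    refine tendsto_atTop_add_const_left _ _ (tendsto_atTop_add_const_right _ _
      (Tendsto.const_mul_atTop (half_pos hkg) ((tendsto_pow_atTop two_ne_zero).comp ?_)))
    simpa only [dist_eq_norm] using tendsto_dist_right_cocompact_atTop m
  obtain ⟨R, hR⟩ := (Metric.closedBall_compl_subset_of_mem_cocompact
    (hcoercive.eventually_ge_atTop (v x)) x)
  have hlsc : LowerSemicontinuous fun y => v y + k / 2 * ‖x - y‖ ^ 2 :=
    hv.add (by fun_prop : Continuous fun y => k / 2 * ‖x - y‖ ^ 2).lowerSemicontinuous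
  obtain ⟨z, -, hz⟩ := (hlsc.lowerSemicontinuousOn _).exists_isMinOn
    ⟨x, Metric.mem_closedBall_self (le_max_right R 0)⟩ (isCompact_closedBall x (max R 0))
  refine ⟨z, fun y => ?_⟩
  by_cases hy : y ∈ Metric.closedBall x (max R 0)
  · exact hz hy
  · have hyR : y ∈ (Metric.closedBall x R)ᶜ :=
      fun h => hy (Metric.closedBall_subset_closedBall (le_max_left R 0) h)
    have hzx : v z + k / 2 * ‖x - z‖ ^ 2 ≤ v x := by
      simpa using hz (Metric.mem_closedBall_self (le_max_right R 0))
    have hvx : v x ≤ c + ((k - g) / 2 * ‖y - m‖ ^ 2 - g * k / (k - g) / 2 * ‖x - ξ‖ ^ 2) := hR hyR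
    rw [← complete_square hkg.ne'] at hvx
    linarith [hle y]

namespace IsInfConvolution

variable {v U : E → ℝ} {z : E → E} {c : ℝ} {ξ : E}

lemma paraboloid_le (h : IsInfConvolution k v U z) (hgk : g < k)
    (hle : ∀ y, c - g / 2 * ‖y - ξ‖ ^ 2 ≤ v y) (x : E) :
    c - g * k / (k - g) / 2 * ‖x - ξ‖ ^ 2 ≤ U x := by
  have hkg : 0 < k - g := sub_pos.2 hgk
  have hsq := complete_square hkg.ne' x (z x) ξ
  have : 0 ≤ (k - g) / 2 * ‖z x - (x + (g / (k - g)) • (x - ξ))‖ ^ 2 := by positivity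
  rw [h.eq x]
  linarith [hle (z x)]

lemma strongConcaveOn (h : IsInfConvolution k v U z) : StrongConcaveOn univ (-k) U := by
  refine ⟨convex_univ, fun x _ y _ a b ha hb hab => ?_⟩
  simp only [smul_eq_mul]
  rw [h.eq (a • x + b • y), norm_convexComb_sub_sq hab]
  set w := z (a • x + b • y)
  have hx : a * U x ≤ a * (v w + k / 2 * ‖x - w‖ ^ 2) := by gcongr; exact h.le x w
  have hy : b * U y ≤ b * (v w + k / 2 * ‖y - w‖ ^ 2) := by gcongr; exact h.le y w
  linear_combination hx + hy + v w * hab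

lemma add_sq_le (h : IsInfConvolution k v U z) (hv : StrongConvexOn univ (-g) v) (x y : E) :
    U x + (k - g) / 4 * ‖z x - y‖ ^ 2 ≤ v y + k / 2 * ‖x - y‖ ^ 2 := by
  have hhalf : (1 / 2 : ℝ) + 1 / 2 = 1 := by norm_num
  have hmid := h.le x ((1 / 2 : ℝ) • z x + (1 / 2 : ℝ) • y)
  have hconv := hv.2 (mem_univ (z x)) (mem_univ y) one_half_pos.le one_half_pos.le hhalf
  rw [norm_sub_rev x, norm_convexComb_sub_sq hhalf, norm_sub_rev _ x, norm_sub_rev _ x] at hmid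
  simp only [smul_eq_mul] at hconv
  linarith [h.eq x]

lemma norm_sub_le (h : IsInfConvolution k v U z) (hv : StrongConvexOn univ (-g) v) (hk : 0 ≤ k)
    (hgk : g < k) (x y : E) : ‖z x - z y‖ ≤ 2 * k / (k - g) * ‖x - y‖ := by
  have hkg : 0 < k - g := sub_pos.2 hgk
  have hx := h.add_sq_le hv x (z y)
  have hy := h.add_sq_le hv y (z x)
  have hcross : ‖x - z y‖ ^ 2 + ‖y - z x‖ ^ 2 =
      ‖x - z x‖ ^ 2 + ‖y - z y‖ ^ 2 + 2 * ⟪x - y, z x - z y⟫ := by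
    simp only [norm_sub_sq_real, inner_sub_left, inner_sub_right]
    ring
  have hinner : k * ⟪x - y, z x - z y⟫ ≤ k * (‖x - y‖ * ‖z x - z y‖) := by
    gcongr
    exact real_inner_le_norm _ _
  rw [norm_sub_rev (z y), h.eq] at hy
  rw [h.eq] at hx
  have hsq : (k - g) / 2 * ‖z x - z y‖ ^ 2 ≤ k * (‖x - y‖ * ‖z x - z y‖) := by
    linear_combination hx + hy + k / 2 * hcross + hinner
  rw [div_mul_eq_mul_div, le_div_iff₀ hkg]
  rcases (norm_nonneg (z x - z y)).eq_or_lt with h0 | hpos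
  · rw [← h0, zero_mul]
    positivity
  · exact le_of_mul_le_mul_right (by linarith) hpos

lemma exists_lipschitzWith (h : IsInfConvolution k v U z) (hv : StrongConvexOn univ (-g) v)
    (hk : 0 ≤ k) (hgk : g < k) : ∃ C, LipschitzWith C fun x => k • (x - z x) :=
  ⟨_, (lipschitzWith_smul k).comp <| LipschitzWith.id.sub <| .of_dist_le' fun x y => by
    simpa only [dist_eq_norm] using h.norm_sub_le hv hk hgk x y⟩

lemma le_add_inner (h : IsInfConvolution k v U z) (x y : E) :
    U y ≤ U x + ⟪k • (x - z x), y - x⟫ + k / 2 * ‖y - x‖ ^ 2 := by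
  have hle := h.le y (z x)
  rw [show y - z x = (x - z x) + (y - x) by abel, norm_add_sq_real] at hle
  rw [h.eq x, real_inner_smul_left]
  linarith

lemma hasGradientAt [CompleteSpace E] (h : IsInfConvolution k v U z)
    (hv : StrongConvexOn univ (-g) v) (hk : 0 ≤ k) (hgk : g < k) (x : E) :
    HasGradientAt U (k • (x - z x)) x := by
  obtain ⟨C, hC⟩ := h.exists_lipschitzWith hv hk hgk
  have hbound : ∀ y, ‖U (x + y) - U x - ⟪k • (x - z x), y⟫‖ ≤ (C + k) * ‖‖y‖ ^ 2‖ := by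
    intro y
    have hupper := h.le_add_inner x (x + y)
    have hlower := h.le_add_inner (x + y) x
    have hlip : ⟪k • (x - z x) - k • (x + y - z (x + y)), y⟫ ≤ C * ‖y‖ ^ 2 := by
      refine (real_inner_le_norm _ _).trans ?_
      have := hC.norm_sub_le x (x + y)
      rw [sub_add_cancel_left, norm_neg] at this
      nlinarith [norm_nonneg y]
    rw [add_sub_cancel_left] at hupper
    rw [sub_add_cancel_left, inner_neg_right, norm_neg] at hlower
    rw [inner_sub_left] at hlip
    have : 0 ≤ k * ‖y‖ ^ 2 := by positivity
    have : 0 ≤ C * ‖y‖ ^ 2 := by positivity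
    rw [Real.norm_of_nonneg (sq_nonneg ‖y‖), Real.norm_eq_abs, abs_le]
    constructor <;> linarith
  rw [hasGradientAt_iff_hasFDerivAt, hasFDerivAt_iff_isLittleO_nhds_zero]
  exact (Asymptotics.IsBigO.of_bound _ (.of_forall hbound)).trans_isLittleO
    (Asymptotics.isLittleO_norm_pow_id one_lt_two)

end IsInfConvolution

-- On the segment from `x` to `x + d`, semiconcavity keeps `f` above the paraboloid of curvature `k`
-- that touches `f` at `x`.
lemma le_inner_of_strongConcaveOn [CompleteSpace E] {f : E → ℝ} {P : E → E} {T : E →L[ℝ] E}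
    {x d : E} (hf : ∀ y, HasGradientAt f (P y) y) (hP : HasFDerivAt P T x)
    (hconc : StrongConcaveOn univ (-k) f)
    (hle : f x + ⟪P x, d⟫ + k / 2 * ‖d‖ ^ 2 ≤ f (x + d)) : k * ‖d‖ ^ 2 ≤ ⟪T d, d⟫ := by
  have hge : ∀ᶠ t : ℝ in 𝓝[>] 0,
      k / 2 * ‖d‖ ^ 2 ≤ (f (x + t • d) - f x - t * ⟪P x, d⟫) / t ^ 2 := by
    filter_upwards [Ioc_mem_nhdsGT one_pos] with t ht
    have hseg := hconc.2 (mem_univ x) (mem_univ (x + d)) (sub_nonneg.2 ht.2) ht.1.le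
      (sub_add_cancel 1 t)
    rw [show (1 - t) • x + t • (x + d) = x + t • d by module, sub_add_cancel_left, norm_neg] at hseg
    simp only [smul_eq_mul] at hseg
    have := mul_le_mul_of_nonneg_left hle ht.1.le
    rw [le_div_iff₀ (pow_pos ht.1 2)]
    linarith
  have := ge_of_tendsto ((tendsto_second_difference_quotient_of_hasGradientAt hf hP d).mono_left
    (nhdsGT_le_nhdsNE 0)) hge
  linarith

-- If `c - g / 2 * ‖· - ξ‖ ^ 2` touches `v` at `z x`, then the paraboloid with vertex `ξ` below `U`
-- touches `U` at some `y`, and the bound on the second derivative at `x` forces `y = x`.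
lemma IsInfConvolution.eq_paraboloid [CompleteSpace E] {v U : E → ℝ} {z : E → E} {c : ℝ} {x ξ : E}
    {T : E →L[ℝ] E} (h : IsInfConvolution k v U z) (hv : StrongConvexOn univ (-g) v) (hk : 0 < k)
    (hgk : g < k) (hT : HasFDerivAt (fun x => k • (x - z x)) T x)
    (hlt : ∀ d, d ≠ 0 → ⟪T d, d⟫ < k * ‖d‖ ^ 2) (hle : ∀ y, c - g / 2 * ‖y - ξ‖ ^ 2 ≤ v y)
    (heq : v (z x) = c - g / 2 * ‖z x - ξ‖ ^ 2) :
    U x = c - g * k / (k - g) / 2 * ‖x - ξ‖ ^ 2 := by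
  have hkg : k - g ≠ 0 := (sub_pos.2 hgk).ne'
  set y := z x + (g / k) • (ξ - z x) with hy
  have hm : z x - (y + (g / (k - g)) • (y - ξ)) = 0 := by
    have hyξ : y - ξ = ((k - g) / k) • (z x - ξ) := by
      rw [hy, sub_div, div_self hk.ne']
      module
    rw [hyξ, smul_smul, div_mul_div_cancel₀ hkg, hy]
    module
  have hUy : v (z x) + k / 2 * ‖y - z x‖ ^ 2 ≤ U y := by
    have hsq := complete_square hkg y (z x) ξ
    rw [hm, norm_zero] at hsq
    linarith [h.paraboloid_le hgk hle y]
  have hd : y - x = 0 := by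
    by_contra hd
    refine (hlt _ hd).not_ge (le_inner_of_strongConcaveOn (h.hasGradientAt hv hk.le hgk) hT
      h.strongConcaveOn ?_)
    rw [add_sub_cancel, h.eq x, real_inner_smul_left]
    rw [show y - z x = (x - z x) + (y - x) by abel, norm_add_sq_real] at hUy
    linarith
  obtain hyx : y = x := sub_eq_zero.1 hd
  refine le_antisymm ?_ (h.paraboloid_le hgk hle x)
  have hsq := complete_square hkg y (z x) ξ
  rw [hm, norm_zero, hyx] at hsq
  linarith [h.eq x]

section Paraboloid

variable [CompleteSpace E] {U : E → ℝ} {P : E → E} {T : E →L[ℝ] E} {G c : ℝ} {x ξ : E}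

lemma hasGradientAt_add_paraboloid (hU : ∀ y, HasGradientAt U (P y) y) (G : ℝ) (ξ y : E) :
    HasGradientAt (fun y => U y + G / 2 * ‖y - ξ‖ ^ 2) (P y + G • (y - ξ)) y :=
  hasGradientAt_add (hU y) (hasGradientAt_norm_sub_sq G ξ y)

lemma gradient_eq_of_paraboloid_le (hU : ∀ y, HasGradientAt U (P y) y)
    (hle : ∀ y, c - G / 2 * ‖y - ξ‖ ^ 2 ≤ U y) (heq : U x = c - G / 2 * ‖x - ξ‖ ^ 2) :
    P x = G • (ξ - x) := by
  have := eq_zero_of_isLocalMin (hasGradientAt_add_paraboloid hU G ξ x)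
    (isLocalMin_add_paraboloid hle heq)
  rw [eq_neg_of_add_eq_zero_left this, ← smul_neg, neg_sub]

lemma neg_mul_sq_le_of_paraboloid_le (hU : ∀ y, HasGradientAt U (P y) y)
    (hT : HasFDerivAt P T x) (hle : ∀ y, c - G / 2 * ‖y - ξ‖ ^ 2 ≤ U y)
    (heq : U x = c - G / 2 * ‖x - ξ‖ ^ 2) (d : E) : -G * ‖d‖ ^ 2 ≤ ⟪T d, d⟫ := by
  have hder := hT.add (((hasFDerivAt_id x).sub_const ξ).const_smul G)
  have := inner_nonneg_of_isLocalMin (hasGradientAt_add_paraboloid hU G ξ) hder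
    (isLocalMin_add_paraboloid hle heq) d
  simp only [_root_.add_apply, _root_.smul_apply, ContinuousLinearMap.id_apply, inner_add_left,
    real_inner_smul_left, real_inner_self_eq_norm_sq] at this
  linarith

end Paraboloid

end InfConvolution

section SupConvolution

variable {E : Type*} [NormedAddCommGroup E] {K : Set E} {u : E → ℝ} {g : ℝ}

/-- The sup-convolution of `u` over `K` with the kernel `g / 2 * ‖·‖ ^ 2`. -/
noncomputable def supConv (K : Set E) (u : E → ℝ) (g : ℝ) (z : E) : ℝ :=
  sSup ((fun ξ => u ξ - g / 2 * ‖z - ξ‖ ^ 2) '' K)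

lemma exists_isMaxOn_sub_sq (hK : IsCompact K) (hne : K.Nonempty) (hu : UpperSemicontinuousOn u K)
    (g : ℝ) (z : E) : ∃ ξ ∈ K, IsMaxOn (fun ξ => u ξ - g / 2 * ‖z - ξ‖ ^ 2) K ξ := by
  refine UpperSemicontinuousOn.exists_isMaxOn hne hK ?_
  have hc : Continuous fun ξ => -(g / 2 * ‖z - ξ‖ ^ 2) := by fun_prop
  simpa only [sub_eq_add_neg] using hu.add (hc.upperSemicontinuous.upperSemicontinuousOn K)

lemma le_supConv (hK : IsCompact K) (hu : UpperSemicontinuousOn u K) (g : ℝ) (z : E) {ξ : E}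
    (hξ : ξ ∈ K) : u ξ - g / 2 * ‖z - ξ‖ ^ 2 ≤ supConv K u g z := by
  obtain ⟨η, -, hmax⟩ := exists_isMaxOn_sub_sq hK ⟨ξ, hξ⟩ hu g z
  exact le_csSup ⟨_, forall_mem_image.2 fun _ hζ => hmax hζ⟩ (mem_image_of_mem _ hξ)

lemma exists_supConv_eq (hK : IsCompact K) (hne : K.Nonempty) (hu : UpperSemicontinuousOn u K)
    (g : ℝ) (z : E) : ∃ ξ ∈ K, supConv K u g z = u ξ - g / 2 * ‖z - ξ‖ ^ 2 := by
  obtain ⟨ξ, hξ, hmax⟩ := exists_isMaxOn_sub_sq hK hne hu g z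
  exact ⟨ξ, hξ, IsGreatest.csSup_eq
    ⟨mem_image_of_mem _ hξ, forall_mem_image.2 fun _ hη => hmax hη⟩⟩

lemma lowerSemicontinuous_supConv (hK : IsCompact K) (hne : K.Nonempty)
    (hu : UpperSemicontinuousOn u K) (g : ℝ) : LowerSemicontinuous (supConv K u g) := by
  intro x y hy
  obtain ⟨ξ, hξ, h⟩ := exists_supConv_eq hK hne hu g x
  have hc : Continuous fun z => u ξ - g / 2 * ‖z - ξ‖ ^ 2 := by fun_prop
  filter_upwards [hc.continuousAt.eventually_const_lt (h ▸ hy)] with z hz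
  exact hz.trans_le (le_supConv hK hu g z hξ)

lemma strongConvexOn_supConv [InnerProductSpace ℝ E] (hK : IsCompact K) (hne : K.Nonempty)
    (hu : UpperSemicontinuousOn u K) (g : ℝ) : StrongConvexOn univ (-g) (supConv K u g) := by
  refine ⟨convex_univ, fun x _ y _ a b ha hb hab => ?_⟩
  obtain ⟨ξ, hξ, h⟩ := exists_supConv_eq hK hne hu g (a • x + b • y)
  have hx := mul_le_mul_of_nonneg_left (le_supConv hK hu g x hξ) ha
  have hy := mul_le_mul_of_nonneg_left (le_supConv hK hu g y hξ) hb
  rw [h, norm_convexComb_sub_sq hab]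
  simp only [smul_eq_mul]
  linear_combination hx + hy - u ξ * hab

end SupConvolution

section Superjet

variable {E : Type*} [NormedAddCommGroup E] [InnerProductSpace ℝ E] [CompleteSpace E]
  {K : Set E} {u : E → ℝ}

/-- `(p, T)` is a second order superjet of `u` at `ξ` relative to `K`; the second derivative is
encoded as a self-adjoint operator. The usual remainder `o(‖η - ξ‖ ^ 2)` is one-sided, hence the
`ε`. -/
def IsSuperjet (u : E → ℝ) (K : Set E) (ξ p : E) (T : E →L[ℝ] E) : Prop :=
  ξ ∈ K ∧ IsSelfAdjoint T ∧ ∀ ε > 0, ∀ᶠ η in 𝓝[K] ξ,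
    u η ≤ u ξ + ⟪p, η - ξ⟫ + 1 / 2 * ⟪T (η - ξ), η - ξ⟫ + ε * ‖η - ξ‖ ^ 2

lemma IsSuperjet.add_inner {q a ξ p : E} {T : E →L[ℝ] E}
    (h : IsSuperjet (fun x => u x - ⟪q, x - a⟫) K ξ p T) : IsSuperjet u K ξ (q + p) T := by
  refine ⟨h.1, h.2.1, fun ε hε => ?_⟩
  filter_upwards [h.2.2 ε hε] with η hη
  rw [← sub_sub_sub_cancel_right η ξ a] at hη ⊢
  rw [inner_add_left, inner_sub_right q]
  linarith

lemma isSuperjet_of_contact {U : E → ℝ} {P : E → E} {T : E →L[ℝ] E} {G : ℝ} {x ξ : E}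
    (hU : ∀ y, HasGradientAt U (P y) y) (hT : HasFDerivAt P T x)
    (hle : ∀ η ∈ K, ∀ y, u η - G / 2 * ‖y - η‖ ^ 2 ≤ U y) (hξ : ξ ∈ K)
    (heq : U x = u ξ - G / 2 * ‖x - ξ‖ ^ 2) : IsSuperjet u K ξ (P x) T := by
  refine ⟨hξ, isSelfAdjoint_of_hasGradientAt hU hT, fun ε hε => ?_⟩
  have hsub : Tendsto (fun η => η - ξ) (𝓝[K] ξ) (𝓝 0) :=
    (continuousWithinAt_id.sub continuousWithinAt_const).tendsto.trans_eq (by simp)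
  have hexp := isLittleO_second_order_expansion (fun y => (hU y).hasFDerivAt)
    (hasFDerivAt_toDual_comp hT)
  filter_upwards [hsub.eventually (hexp.bound hε), self_mem_nhdsWithin] with η hη hηK
  have hηx := hle η hηK (x + (η - ξ))
  rw [show x + (η - ξ) - η = x - ξ by abel] at hηx
  rw [norm_pow, norm_norm] at hη
  have hexpη : U (x + (η - ξ)) - U x - ⟪P x, η - ξ⟫ - 1 / 2 * ⟪T (η - ξ), η - ξ⟫ ≤
      ε * ‖η - ξ‖ ^ 2 := (le_abs_self _).trans hη
  linarith

-- The Lasry-Lions regularization of `u` keeps the superjets of `u`, up to a shift of the base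
-- point.
lemma IsInfConvolution.exists_isSuperjet {U : E → ℝ} {z : E → E} {T : E →L[ℝ] E} {g k : ℝ} {x : E}
    (h : IsInfConvolution k (supConv K u g) U z) (hK : IsCompact K) (hne : K.Nonempty)
    (hu : UpperSemicontinuousOn u K) (hg : 0 < g) (hgk : g < k)
    (hT : HasFDerivAt (fun x => k • (x - z x)) T x)
    (hlt : ∀ d, d ≠ 0 → ⟪T d, d⟫ < k * ‖d‖ ^ 2) :
    ∃ ξ, IsSuperjet u K ξ (k • (x - z x)) T ∧ g * ‖ξ - x‖ ≤ ‖k • (x - z x)‖ ∧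
      |u ξ - U x| ≤ ‖k • (x - z x)‖ * ‖ξ - x‖ ∧
      ∀ d, -(g * k / (k - g)) * ‖d‖ ^ 2 ≤ ⟪T d, d⟫ := by
  have hk : 0 < k := hg.trans hgk
  have hconv := strongConvexOn_supConv hK hne hu g
  have hgrad := h.hasGradientAt hconv hk.le hgk
  have hle : ∀ η ∈ K, ∀ y, u η - g * k / (k - g) / 2 * ‖y - η‖ ^ 2 ≤ U y := fun η hη =>
    h.paraboloid_le hgk fun y => le_supConv hK hu g y hη
  obtain ⟨ξ, hξ, hzx⟩ := exists_supConv_eq hK hne hu g (z x)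
  have heq := h.eq_paraboloid hconv hk hgk hT hlt (fun y => le_supConv hK hu g y hξ) hzx
  have hgG : g ≤ g * k / (k - g) := by
    rw [le_div_iff₀ (sub_pos.2 hgk)]
    nlinarith
  have hp : ‖k • (x - z x)‖ = g * k / (k - g) * ‖ξ - x‖ := by
    rw [gradient_eq_of_paraboloid_le hgrad (hle ξ hξ) heq, norm_smul,
      Real.norm_of_nonneg (hg.le.trans hgG)]
  refine ⟨ξ, isSuperjet_of_contact (x := x) hgrad hT hle hξ heq, hp ▸ by gcongr, ?_,
    neg_mul_sq_le_of_paraboloid_le hgrad hT (hle ξ hξ) heq⟩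
  have : 0 ≤ g * k / (k - g) * ‖ξ - x‖ ^ 2 := mul_nonneg (hg.le.trans hgG) (sq_nonneg _)
  rw [hp, heq, norm_sub_rev x, sub_sub_cancel, abs_of_nonneg (by linarith)]
  linarith

end Superjet

section Doubling

open WithLp

variable {E : Type*} [NormedAddCommGroup E] [InnerProductSpace ℝ E] {P₁ P₂ : E → E} {g : ℝ} {c : E}

/-- The gradient of `(x, y) ↦ U₁ x + U₂ y - g / 2 * ‖x - y - c‖ ^ 2` on the Hilbert sum `E ⊕ E`,
where `P₁` and `P₂` are the gradients of `U₁` and `U₂`. -/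
def doublingGradient (P₁ P₂ : E → E) (g : ℝ) (c : E) (w : WithLp 2 (E × E)) : WithLp 2 (E × E) :=
  toLp 2 (P₁ w.fst - g • (w.fst - w.snd - c), P₂ w.snd + g • (w.fst - w.snd - c))

lemma hasGradientAt_doubling [CompleteSpace E] {U₁ U₂ : E → ℝ}
    (h₁ : ∀ x, HasGradientAt U₁ (P₁ x) x) (h₂ : ∀ x, HasGradientAt U₂ (P₂ x) x) (g : ℝ) (c : E)
    (w : WithLp 2 (E × E)) :
    HasGradientAt
      (fun w : WithLp 2 (E × E) => U₁ w.fst + U₂ w.snd - g / 2 * ‖w.fst - w.snd - c‖ ^ 2)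
      (doublingGradient P₁ P₂ g c w) w := by
  have hfst := (fstL 2 ℝ E E).hasFDerivAt (x := w)
  have hsnd := (sndL 2 ℝ E E).hasFDerivAt (x := w)
  have hsq := (hasGradientAt_norm_sub_sq g c (w.fst - w.snd)).hasFDerivAt
  rw [hasGradientAt_iff_hasFDerivAt]
  refine ((((h₁ _).hasFDerivAt.comp w hfst).add ((h₂ _).hasFDerivAt.comp w hsnd)).sub
    (hsq.comp w (hfst.sub hsnd))).congr_fderiv ?_
  ext h
  simp only [fstL_apply, sndL_apply, ContinuousLinearMap.comp_apply, _root_.sub_apply,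
    _root_.add_apply, InnerProductSpace.toDual_apply_apply, doublingGradient, prod_inner_apply,
    ofLp_fst, ofLp_snd, map_smul, map_sub, _root_.smul_apply, smul_eq_mul, inner_add_left,
    inner_sub_left, real_inner_smul_left]
  ring

lemma lipschitzWith_doublingGradient {C₁ C₂ : NNReal} (h₁ : LipschitzWith C₁ P₁)
    (h₂ : LipschitzWith C₂ P₂) (g : ℝ) (c : E) :
    ∃ C, LipschitzWith C (doublingGradient P₁ P₂ g c) := by
  have hfst := (fstL 2 ℝ E E).lipschitz
  have hsnd := (sndL 2 ℝ E E).lipschitz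
  have hdiff := (lipschitzWith_smul g).comp ((hfst.sub hsnd).sub (.const c))
  exact ⟨_, (prod_lipschitzWith_toLp 2 E E).comp
    (((h₁.comp hfst).sub hdiff).prodMk ((h₂.comp hsnd).add hdiff))⟩

lemma hasFDerivAt_doublingGradient {T₁ T₂ : E →L[ℝ] E} {w : WithLp 2 (E × E)}
    (h₁ : HasFDerivAt P₁ T₁ w.fst) (h₂ : HasFDerivAt P₂ T₂ w.snd) :
    HasFDerivAt (doublingGradient P₁ P₂ g c)
      ((prodContinuousLinearEquiv 2 ℝ E E).symm.toContinuousLinearMap ∘L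
        ((T₁ ∘L fstL 2 ℝ E E - g • (fstL 2 ℝ E E - sndL 2 ℝ E E)).prod
          (T₂ ∘L sndL 2 ℝ E E + g • (fstL 2 ℝ E E - sndL 2 ℝ E E)))) w := by
  have hfst := (fstL 2 ℝ E E).hasFDerivAt (x := w)
  have hsnd := (sndL 2 ℝ E E).hasFDerivAt (x := w)
  have hdiff := ((hfst.sub hsnd).sub_const c).const_smul g
  exact (prodContinuousLinearEquiv 2 ℝ E E).symm.hasFDerivAt.comp w
    (((h₁.comp w hfst).sub hdiff).prodMk ((h₂.comp w hsnd).add hdiff))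

lemma differentiableAt_of_doublingGradient {w : WithLp 2 (E × E)}
    (h : DifferentiableAt ℝ (doublingGradient P₁ P₂ g c) w) :
    DifferentiableAt ℝ P₁ w.fst ∧ DifferentiableAt ℝ P₂ w.snd := by
  have hlp : Differentiable ℝ (toLp 2 : E × E → WithLp 2 (E × E)) :=
    (prodContinuousLinearEquiv 2 ℝ E E).symm.differentiable
  have hfst : DifferentiableAt ℝ (fun x => doublingGradient P₁ P₂ g c (toLp 2 (x, w.snd))) w.fst :=
    h.comp (g := doublingGradient P₁ P₂ g c) w.fst
      (hlp.comp (differentiable_id.prodMk (differentiable_const _)) _)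
  have hsnd : DifferentiableAt ℝ (fun y => doublingGradient P₁ P₂ g c (toLp 2 (w.fst, y))) w.snd :=
    h.comp (g := doublingGradient P₁ P₂ g c) w.snd
      (hlp.comp ((differentiable_const _).prodMk differentiable_id) _)
  constructor
  · refine (((fstL 2 ℝ E E).differentiableAt.comp _ hfst).add
      (by fun_prop : DifferentiableAt ℝ (fun x => g • (x - w.snd - c)) w.fst)).congr_of_eventuallyEq
      (.of_forall fun x => ?_)
    simp [doublingGradient]
  · refine (((sndL 2 ℝ E E).differentiableAt.comp _ hsnd).sub
      (by fun_prop : DifferentiableAt ℝ (fun y => g • (w.fst - y - c)) w.snd)).congr_of_eventuallyEq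
      (.of_forall fun y => ?_)
    simp [doublingGradient]

lemma exists_almost_max_doubling [FiniteDimensional ℝ E] {U₁ U₂ : E → ℝ} {C₁ C₂ : NNReal}
    (h₁ : ∀ x, HasGradientAt U₁ (P₁ x) x) (h₂ : ∀ x, HasGradientAt U₂ (P₂ x) x)
    (hC₁ : LipschitzWith C₁ P₁) (hC₂ : LipschitzWith C₂ P₂) {a b : E} (hg : 0 ≤ g)
    (hmax : ∀ x y, U₁ x + U₂ y - g / 2 * ‖x - y - (a - b)‖ ^ 2 ≤ U₁ a + U₂ b) {δ : ℝ} (hδ : 0 < δ) :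
    ∃ (x y : E) (T₁ T₂ : E →L[ℝ] E), (‖x - a‖ ≤ δ ∧ ‖P₁ x‖ ≤ δ ∧ HasFDerivAt P₁ T₁ x) ∧
      (‖y - b‖ ≤ δ ∧ ‖P₂ y‖ ≤ δ ∧ HasFDerivAt P₂ T₂ y) ∧
      ∀ h l, ⟪T₁ h, h⟫ + ⟪T₂ l, l⟫ ≤ g * ‖h - l‖ ^ 2 + δ * (‖h‖ ^ 2 + ‖l‖ ^ 2) := by
  obtain ⟨C, hC⟩ := lipschitzWith_doublingGradient hC₁ hC₂ g (a - b)
  set ε := δ / (1 + 2 * g) with hε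
  have hεδ : ε + g * (ε + ε) = δ := by rw [hε]; field_simp; ring
  obtain ⟨w, T, hw, hPw, hT, hTle⟩ := exists_almost_max_twice_differentiable
    (hasGradientAt_doubling h₁ h₂ g (a - b)) hC (w₀ := toLp 2 (a, b))
    (fun w => by simpa using hmax w.fst w.snd) (show 0 < ε by positivity)
  have hεle : ε ≤ δ := hεδ ▸ le_add_of_nonneg_right (by positivity)
  obtain ⟨⟨T₁, hT₁⟩, T₂, hT₂⟩ := differentiableAt_of_doublingGradient hT.differentiableAt
  have hx : ‖w.fst - a‖ ≤ ε := (WithLp.norm_fst_le _ _).trans hw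
  have hy : ‖w.snd - b‖ ≤ ε := (WithLp.norm_snd_le _ _).trans hw
  have hshift : ‖g • (w.fst - w.snd - (a - b))‖ ≤ g * (ε + ε) := by
    rw [norm_smul, Real.norm_of_nonneg hg, sub_sub_sub_comm]
    gcongr
    exact (norm_sub_le _ _).trans (add_le_add hx hy)
  refine ⟨w.fst, w.snd, T₁, T₂, ⟨hx.trans hεle, ?_, hT₁⟩, ⟨hy.trans hεle, ?_, hT₂⟩, fun h l => ?_⟩
  · calc ‖P₁ w.fst‖
        = ‖(doublingGradient P₁ P₂ g (a - b) w).fst + g • (w.fst - w.snd - (a - b))‖ := by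
          simp [doublingGradient]
      _ ≤ ε + g * (ε + ε) := norm_add_le_of_le ((WithLp.norm_fst_le _ _).trans hPw) hshift
      _ = δ := hεδ
  · calc ‖P₂ w.snd‖
        = ‖(doublingGradient P₁ P₂ g (a - b) w).snd - g • (w.fst - w.snd - (a - b))‖ := by
          simp [doublingGradient]
      _ ≤ ε + g * (ε + ε) := norm_sub_le_of_le ((WithLp.norm_snd_le _ _).trans hPw) hshift
      _ = δ := hεδ
  · have hle := hTle (toLp 2 (h, l))
    rw [hT.unique (hasFDerivAt_doublingGradient hT₁ hT₂)] at hle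
    simp only [prod_norm_sq_eq_of_L2, prod_inner_apply, ContinuousLinearMap.comp_apply,
      ContinuousLinearMap.prod_apply, _root_.sub_apply, _root_.add_apply, _root_.smul_apply,
      fstL_apply, sndL_apply, toLp_fst, toLp_snd, ContinuousLinearEquiv.coe_coe,
      prodContinuousLinearEquiv_symm_apply, inner_sub_left, inner_add_left, real_inner_smul_left,
      real_inner_self_eq_norm_sq, real_inner_comm h l] at hle
    have : ε * (‖h‖ ^ 2 + ‖l‖ ^ 2) ≤ δ * (‖h‖ ^ 2 + ‖l‖ ^ 2) := by gcongr
    rw [norm_sub_sq_real]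
    linarith

end Doubling

section LimitingSuperjet

variable {E : Type*} [NormedAddCommGroup E]

lemma supConv_add_supConv_le {K K' : Set E} {u v : E → ℝ} {σ m : ℝ} {c : E} (hK : IsCompact K)
    (hK' : IsCompact K') (hne : K.Nonempty) (hne' : K'.Nonempty) (hu : UpperSemicontinuousOn u K)
    (hv : UpperSemicontinuousOn v K') (hσ : 0 ≤ σ)
    (hle : ∀ x ∈ K, ∀ y ∈ K', u x + v y ≤ m + σ / 2 * ‖x - y - c‖ ^ 2) (x y : E) :
    supConv K u (3 * σ) x + supConv K' v (3 * σ) y ≤ m + 3 * σ / 2 * ‖x - y - c‖ ^ 2 := by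
  obtain ⟨ξ, hξ, hx⟩ := exists_supConv_eq hK hne hu (3 * σ) x
  obtain ⟨η, hη, hy⟩ := exists_supConv_eq hK' hne' hv (3 * σ) y
  have hnorm : ‖ξ - η - c‖ ≤ ‖x - y - c‖ + ‖x - ξ‖ + ‖y - η‖ := by
    rw [show ξ - η - c = x - y - c - (x - ξ) + (y - η) by abel]
    exact norm_add_le_of_le (norm_sub_le _ _) le_rfl
  have hsq : ‖ξ - η - c‖ ^ 2 ≤ 3 * (‖x - y - c‖ ^ 2 + ‖x - ξ‖ ^ 2 + ‖y - η‖ ^ 2) := by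
    refine (pow_le_pow_left₀ (norm_nonneg _) hnorm 2).trans ?_
    linarith [sq_nonneg (‖x - y - c‖ - ‖x - ξ‖), sq_nonneg (‖x - y - c‖ - ‖y - η‖),
      sq_nonneg (‖x - ξ‖ - ‖y - η‖)]
  have := mul_le_mul_of_nonneg_left hsq (by positivity : 0 ≤ σ / 2)
  rw [hx, hy]
  linarith [hle ξ hξ η hη]

variable [InnerProductSpace ℝ E] [CompleteSpace E]

/-- The graph of the second order superjet of `u` relative to `K`, together with the values of `u`:
all `(ξ, u ξ, p, T)` with `(p, T)` a superjet at `ξ`. -/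
def superjetGraph (u : E → ℝ) (K : Set E) : Set (E × ℝ × E × (E →L[ℝ] E)) :=
  {j | u j.1 = j.2.1 ∧ IsSuperjet u K j.1 j.2.2.1 j.2.2.2}

/-- `(p, T)` lies in the closed second order superjet of `u` at `a` relative to `K`: it is a limit
of superjets at points `ξ → a` with `u ξ → u a`. -/
def IsLimitingSuperjet (u : E → ℝ) (K : Set E) (a p : E) (T : E →L[ℝ] E) : Prop :=
  (a, u a, p, T) ∈ closure (superjetGraph u K)

lemma IsLimitingSuperjet.isSelfAdjoint {K : Set E} {u : E → ℝ} {a p : E} {T : E →L[ℝ] E}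
    (h : IsLimitingSuperjet u K a p T) : IsSelfAdjoint T := by
  have hT : Tendsto (fun j : E × ℝ × E × (E →L[ℝ] E) => j.2.2.2)
      (𝓝[superjetGraph u K] (a, u a, p, T)) (𝓝 T) := Continuous.continuousWithinAt (by fun_prop)
  have : (𝓝[superjetGraph u K] (a, u a, p, T)).NeBot := mem_closure_iff_nhdsWithin_neBot.1 h
  refine tendsto_nhds_unique_of_eventuallyEq ((continuous_star.tendsto T).comp hT) hT ?_
  filter_upwards [self_mem_nhdsWithin] with j hj using hj.2.2.1

lemma IsLimitingSuperjet.add_inner {K : Set E} {u : E → ℝ} {a p q : E} {T : E →L[ℝ] E}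
    (h : IsLimitingSuperjet (fun x => u x - ⟪q, x - a⟫) K a p T) :
    IsLimitingSuperjet u K a (q + p) T := by
  have hc : Continuous fun j : E × ℝ × E × (E →L[ℝ] E) =>
      (j.1, j.2.1 + ⟪q, j.1 - a⟫, q + j.2.2.1, j.2.2.2) := by fun_prop
  have hmaps : MapsTo (fun j : E × ℝ × E × (E →L[ℝ] E) =>
      (j.1, j.2.1 + ⟪q, j.1 - a⟫, q + j.2.2.1, j.2.2.2))
      (superjetGraph (fun x => u x - ⟪q, x - a⟫) K) (superjetGraph u K) :=
    fun j hj => ⟨sub_eq_iff_eq_add.1 hj.1, hj.2.add_inner⟩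
  simpa [IsLimitingSuperjet] using map_mem_closure hc h hmaps

lemma IsInfConvolution.exists_forall_isSuperjet_near {K : Set E} {u U : E → ℝ} {z : E → E}
    {g k δ : ℝ} {a : E} (h : IsInfConvolution k (supConv K u g) U z) (hK : IsCompact K)
    (hne : K.Nonempty) (hu : UpperSemicontinuousOn u K) (hg : 0 < g) (hgk : g < k)
    (ha : U a = u a) (hδ : 0 < δ) :
    ∃ ρ > 0, ∀ x T, ‖x - a‖ ≤ ρ → ‖k • (x - z x)‖ ≤ ρ →
      HasFDerivAt (fun x => k • (x - z x)) T x → (∀ d, d ≠ 0 → ⟪T d, d⟫ < k * ‖d‖ ^ 2) →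
      ∃ ξ, IsSuperjet u K ξ (k • (x - z x)) T ∧
        dist (ξ, u ξ, k • (x - z x)) (a, u a, 0) ≤ δ ∧
        ∀ d, -(g * k / (k - g)) * ‖d‖ ^ 2 ≤ ⟪T d, d⟫ := by
  have hcont : ContinuousAt U a :=
    (h.hasGradientAt (strongConvexOn_supConv hK hne hu g) (hg.trans hgk).le hgk a).continuousAt
  obtain ⟨r, hr, hUr⟩ := Metric.continuousAt_iff.1 hcont (δ / 2) (half_pos hδ)
  refine ⟨min (r / 2) (min 1 (δ / 2 * g / (1 + g))), by positivity, fun x T hx hp hT hlt => ?_⟩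
  simp only [le_min_iff] at hx hp
  obtain ⟨ξ, hξ, hξx, huξ, hlow⟩ := h.exists_isSuperjet hK hne hu hg hgk hT hlt
  have hξδ : ‖ξ - x‖ ≤ δ / 2 / (1 + g) := by
    rw [le_div_iff₀ (by positivity)]
    have := hξx.trans hp.2.2
    rw [le_div_iff₀ (by positivity)] at this
    nlinarith
  have hξδ' : ‖ξ - x‖ ≤ δ / 2 := hξδ.trans (div_le_self (by positivity) (by linarith))
  have hxδ : ‖x - a‖ ≤ δ / 2 := hx.2.2.trans
    ((div_le_iff₀ (by positivity)).2 (by nlinarith))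
  have hUx : |U x - U a| < δ / 2 := hUr (by rw [dist_eq_norm]; linarith [hx.1])
  refine ⟨ξ, hξ, ?_, hlow⟩
  simp only [Prod.dist_eq, dist_zero_right, max_le_iff, dist_eq_norm ξ, Real.dist_eq]
  refine ⟨?_, ?_, ?_⟩
  · rw [← sub_add_sub_cancel ξ x a]
    exact norm_add_le_of_le hξδ' hxδ |>.trans_eq (add_halves δ)
  · rw [← sub_add_sub_cancel (u ξ) (U x) (u a), ← ha]
    have := huξ.trans (mul_le_of_le_one_left (norm_nonneg _) hp.2.1)
    exact (abs_add_le _ _).trans (by linarith)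
  · refine hp.2.2.trans ((div_le_iff₀ (by positivity)).2 (by nlinarith))

lemma isLimitingSuperjet_of_tendsto {K : Set E} {u : E → ℝ} {ξ p : ℕ → E} {T : ℕ → E →L[ℝ] E}
    {a q : E} {S : E →L[ℝ] E} (h : ∀ n, IsSuperjet u K (ξ n) (p n) (T n))
    (hξ : Tendsto (fun n => (ξ n, u (ξ n), p n)) atTop (𝓝 (a, u a, q)))
    (hT : Tendsto T atTop (𝓝 S)) : IsLimitingSuperjet u K a q S :=
  mem_closure_of_tendsto (f := fun n => (ξ n, u (ξ n), p n, T n))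
    (hξ.fst_nhds.prodMk_nhds
      (hξ.snd_nhds.fst_nhds.prodMk_nhds (hξ.snd_nhds.snd_nhds.prodMk_nhds hT)))
    (.of_forall fun n => ⟨rfl, h n⟩)

end LimitingSuperjet

section TheoremOnSums

variable {E : Type*} [NormedAddCommGroup E] [InnerProductSpace ℝ E] [FiniteDimensional ℝ E]
  {K K' : Set E} {u v : E → ℝ} {σ : ℝ} {a b : E}

lemma norm_le_of_isSelfAdjoint {T : E →L[ℝ] E} (hT : IsSelfAdjoint T) {M : ℝ} (hM : 0 ≤ M)
    (hlow : ∀ d, -M * ‖d‖ ^ 2 ≤ ⟪T d, d⟫) (hup : ∀ d, ⟪T d, d⟫ ≤ M * ‖d‖ ^ 2) : ‖T‖ ≤ M := by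
  rw [T.norm_eq_iSup_rayleighQuotient hT.isSymmetric]
  refine ciSup_le fun d => ?_
  rw [ContinuousLinearMap.rayleighQuotient, abs_div, abs_sq]
  exact div_le_of_le_mul₀ (sq_nonneg _) hM (abs_le.2 ⟨neg_mul M _ ▸ hlow d, hup d⟩)

lemma exists_isInfConvolution_doubling {k : ℝ} (hK : IsCompact K) (hK' : IsCompact K')
    (hu : UpperSemicontinuousOn u K) (hv : UpperSemicontinuousOn v K') (ha : a ∈ K) (hb : b ∈ K')
    (hσ : 0 ≤ σ) (hσk : 3 * σ < k)
    (hle : ∀ x ∈ K, ∀ y ∈ K', u x + v y ≤ u a + v b + σ / 2 * ‖x - y - (a - b)‖ ^ 2) :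
    ∃ U z V w, (IsInfConvolution k (supConv K u (3 * σ)) U z ∧ U a = u a) ∧
      (IsInfConvolution k (supConv K' v (3 * σ)) V w ∧ V b = v b) ∧
      ∀ x y, U x + V y - 3 * σ / 2 * ‖x - y - (a - b)‖ ^ 2 ≤ U a + V b := by
  have hne : K.Nonempty := ⟨a, ha⟩
  have hne' : K'.Nonempty := ⟨b, hb⟩
  have hua := fun y => le_supConv hK hu (3 * σ) y ha
  have hvb := fun y => le_supConv hK' hv (3 * σ) y hb
  obtain ⟨U, z, hU⟩ := exists_isInfConvolution (lowerSemicontinuous_supConv hK hne hu _) hσk hua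
  obtain ⟨V, w, hV⟩ := exists_isInfConvolution (lowerSemicontinuous_supConv hK' hne' hv _) hσk hvb
  have hUa : u a ≤ U a := by simpa using hU.paraboloid_le hσk hua a
  have hVb : v b ≤ V b := by simpa using hV.paraboloid_le hσk hvb b
  have hmax : ∀ x y, U x + V y - 3 * σ / 2 * ‖x - y - (a - b)‖ ^ 2 ≤ u a + v b := fun x y => by
    linarith [hU.le_self x, hV.le_self y,
      supConv_add_supConv_le hK hK' hne hne' hu hv hσ hle x y]
  have hab : U a + V b ≤ u a + v b := by simpa using hmax a b
  exact ⟨U, z, V, w, ⟨hU, by linarith⟩, ⟨hV, by linarith⟩, fun x y => by linarith [hmax x y]⟩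

lemma exists_mul_div_sub_le (g : ℝ) {δ : ℝ} (hδ : 0 < δ) :
    ∃ k, g + δ < k ∧ g * k / (k - g) ≤ g + δ := by
  have hsq : 0 ≤ g ^ 2 / δ := by positivity
  refine ⟨g + (g ^ 2 / δ + 1 + δ), by linarith, ?_⟩
  rw [add_sub_cancel_left, div_le_iff₀ (by positivity)]
  linarith [mul_div_cancel₀ (g ^ 2) hδ.ne', sq_nonneg δ]

lemma exists_isSuperjet_near_of_add_le (hK : IsCompact K) (hK' : IsCompact K')
    (hu : UpperSemicontinuousOn u K) (hv : UpperSemicontinuousOn v K') (ha : a ∈ K) (hb : b ∈ K')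
    (hσ : 0 < σ)
    (hle : ∀ x ∈ K, ∀ y ∈ K', u x + v y ≤ u a + v b + σ / 2 * ‖x - y - (a - b)‖ ^ 2)
    {δ : ℝ} (hδ : 0 < δ) :
    ∃ (ξ η p q : E) (T₁ T₂ : E →L[ℝ] E),
      (IsSuperjet u K ξ p T₁ ∧ dist (ξ, u ξ, p) (a, u a, 0) ≤ δ ∧ ‖T₁‖ ≤ 3 * σ + δ) ∧
      (IsSuperjet v K' η q T₂ ∧ dist (η, v η, q) (b, v b, 0) ≤ δ ∧ ‖T₂‖ ≤ 3 * σ + δ) ∧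
      ∀ h l, ⟪T₁ h, h⟫ + ⟪T₂ l, l⟫ ≤ 3 * σ * ‖h - l‖ ^ 2 + δ * (‖h‖ ^ 2 + ‖l‖ ^ 2) := by
  set g := 3 * σ
  have hg : 0 < g := by positivity
  obtain ⟨k, hδk, hcurv⟩ := exists_mul_div_sub_le g hδ
  have hgk : g < k := by linarith
  have hk := (hg.trans hgk).le
  have hne : K.Nonempty := ⟨a, ha⟩
  have hne' : K'.Nonempty := ⟨b, hb⟩
  have hcu := strongConvexOn_supConv hK hne hu g
  have hcv := strongConvexOn_supConv hK' hne' hv g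
  obtain ⟨U, z, V, w, ⟨hU, hUa⟩, ⟨hV, hVb⟩, hmax⟩ :=
    exists_isInfConvolution_doubling hK hK' hu hv ha hb hσ.le hgk hle
  obtain ⟨ρ, hρ, hjetu⟩ := hU.exists_forall_isSuperjet_near hK hne hu hg hgk hUa hδ
  obtain ⟨ρ', hρ', hjetv⟩ := hV.exists_forall_isSuperjet_near hK' hne' hv hg hgk hVb hδ
  obtain ⟨C, hC⟩ := hU.exists_lipschitzWith hcu hk hgk
  obtain ⟨C', hC'⟩ := hV.exists_lipschitzWith hcv hk hgk
  obtain ⟨x, y, T₁, T₂, ⟨hx, hp, hT₁⟩, ⟨hy, hq, hT₂⟩, hsum⟩ := exists_almost_max_doubling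
    (hU.hasGradientAt hcu hk hgk) (hV.hasGradientAt hcv hk hgk) hC hC' hg.le hmax
    (δ := min δ (min ρ ρ')) (by positivity)
  simp only [le_min_iff] at hx hp hy hq
  replace hsum : ∀ h l, ⟪T₁ h, h⟫ + ⟪T₂ l, l⟫ ≤ g * ‖h - l‖ ^ 2 + δ * (‖h‖ ^ 2 + ‖l‖ ^ 2) :=
    fun h l => (hsum h l).trans (by gcongr; exact min_le_left _ _)
  have hup (d : E) : ⟪T₁ d, d⟫ ≤ (g + δ) * ‖d‖ ^ 2 := by linarith [by simpa using hsum d 0]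
  have hup' (d : E) : ⟪T₂ d, d⟫ ≤ (g + δ) * ‖d‖ ^ 2 := by linarith [by simpa using hsum 0 d]
  have hlt (d : E) (hd : d ≠ 0) : (g + δ) * ‖d‖ ^ 2 < k * ‖d‖ ^ 2 := by gcongr
  obtain ⟨ξ, hξ, hξa, hlow⟩ := hjetu x T₁ hx.2.1 hp.2.1 hT₁ fun d hd => (hup d).trans_lt (hlt d hd)
  obtain ⟨η, hη, hηb, hlow'⟩ :=
    hjetv y T₂ hy.2.2 hq.2.2 hT₂ fun d hd => (hup' d).trans_lt (hlt d hd)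
  refine ⟨ξ, η, _, _, T₁, T₂, ⟨hξ, hξa, ?_⟩, ⟨hη, hηb, ?_⟩, hsum⟩
  · exact norm_le_of_isSelfAdjoint hξ.2.1 (by positivity)
      (fun d => (by gcongr : _ ≤ _).trans (hlow d)) hup
  · exact norm_le_of_isSelfAdjoint hη.2.1 (by positivity)
      (fun d => (by gcongr : _ ≤ _).trans (hlow' d)) hup'

lemma exists_isLimitingSuperjet_of_add_le (hK : IsCompact K) (hK' : IsCompact K')
    (hu : UpperSemicontinuousOn u K) (hv : UpperSemicontinuousOn v K') (ha : a ∈ K) (hb : b ∈ K')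
    (hσ : 0 < σ)
    (hle : ∀ x ∈ K, ∀ y ∈ K', u x + v y ≤ u a + v b + σ / 2 * ‖x - y - (a - b)‖ ^ 2) :
    ∃ T₁ T₂ : E →L[ℝ] E, IsLimitingSuperjet u K a 0 T₁ ∧ IsLimitingSuperjet v K' b 0 T₂ ∧
      ‖T₁‖ ≤ 3 * σ ∧ ‖T₂‖ ≤ 3 * σ ∧
      ∀ h l, ⟪T₁ h, h⟫ + ⟪T₂ l, l⟫ ≤ 3 * σ * ‖h - l‖ ^ 2 := by
  choose ξ η p q T₁ T₂ hjet hjet' hsum using fun n : ℕ =>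
    exists_isSuperjet_near_of_add_le hK hK' hu hv ha hb hσ hle (Nat.one_div_pos_of_nat (n := n))
  have hδ (n : ℕ) : 3 * σ + 1 / ((n : ℝ) + 1) ≤ 3 * σ + 1 := by
    gcongr
    exact div_le_one_of_le₀ (by linarith [n.cast_nonneg (α := ℝ)]) (by positivity)
  obtain ⟨⟨S₁, S₂⟩, -, φ, hφ, hlim⟩ := ((isCompact_closedBall 0 (3 * σ + 1)).prod
    (isCompact_closedBall 0 (3 * σ + 1))).tendsto_subseq (x := fun n => (T₁ n, T₂ n)) fun n =>
      ⟨mem_closedBall_zero_iff.2 ((hjet n).2.2.trans (hδ n)),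
        mem_closedBall_zero_iff.2 ((hjet' n).2.2.trans (hδ n))⟩
  have hS₁ : Tendsto (T₁ ∘ φ) atTop (𝓝 S₁) := hlim.fst_nhds
  have hS₂ : Tendsto (T₂ ∘ φ) atTop (𝓝 S₂) := hlim.snd_nhds
  have hzero : Tendsto (fun n => 1 / ((φ n : ℝ) + 1)) atTop (𝓝 0) :=
    tendsto_one_div_add_atTop_nhds_zero_nat.comp hφ.tendsto_atTop
  have hbound : Tendsto (fun n => 3 * σ + 1 / ((φ n : ℝ) + 1)) atTop (𝓝 (3 * σ)) := by
    simpa using hzero.const_add (3 * σ)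
  refine ⟨S₁, S₂, isLimitingSuperjet_of_tendsto (fun n => (hjet (φ n)).1) ?_ hS₁,
    isLimitingSuperjet_of_tendsto (fun n => (hjet' (φ n)).1) ?_ hS₂,
    le_of_tendsto_of_tendsto' hS₁.norm hbound fun n => (hjet (φ n)).2.2,
    le_of_tendsto_of_tendsto' hS₂.norm hbound fun n => (hjet' (φ n)).2.2, fun h l => ?_⟩
  · exact tendsto_iff_dist_tendsto_zero.2
      (squeeze_zero (fun _ => dist_nonneg) (fun n => (hjet (φ n)).2.1) hzero)
  · exact tendsto_iff_dist_tendsto_zero.2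
      (squeeze_zero (fun _ => dist_nonneg) (fun n => (hjet' (φ n)).2.1) hzero)
  · have hc : Continuous fun S : (E →L[ℝ] E) × (E →L[ℝ] E) => ⟪S.1 h, h⟫ + ⟪S.2 l, l⟫ := by
      fun_prop
    refine le_of_tendsto_of_tendsto' ((hc.tendsto (S₁, S₂)).comp hlim) ?_ fun n => hsum (φ n) h l
    simpa using (hzero.mul_const (‖h‖ ^ 2 + ‖l‖ ^ 2)).const_add (3 * σ * ‖h - l‖ ^ 2)

theorem exists_isLimitingSuperjet_of_isMax_doubling (hK : IsCompact K) (hK' : IsCompact K')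
    (hu : UpperSemicontinuousOn u K) (hv : UpperSemicontinuousOn v K') (ha : a ∈ K) (hb : b ∈ K')
    (hσ : 0 < σ)
    (hmax : ∀ x ∈ K, ∀ y ∈ K',
      u x + v y - σ / 2 * ‖x - y‖ ^ 2 ≤ u a + v b - σ / 2 * ‖a - b‖ ^ 2) :
    ∃ T₁ T₂ : E →L[ℝ] E, IsLimitingSuperjet u K a (σ • (a - b)) T₁ ∧
      IsLimitingSuperjet v K' b (-(σ • (a - b))) T₂ ∧ ‖T₁‖ ≤ 3 * σ ∧ ‖T₂‖ ≤ 3 * σ ∧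
      ∀ h l, ⟪T₁ h, h⟫ + ⟪T₂ l, l⟫ ≤ 3 * σ * ‖h - l‖ ^ 2 := by
  set p := σ • (a - b) with hp
  have hsub {q c : E} {f : E → ℝ} {A : Set E} (hf : UpperSemicontinuousOn f A) :
      UpperSemicontinuousOn (fun x => f x - ⟪q, x - c⟫) A := by
    have hc : Continuous fun x => -⟪q, x - c⟫ := by fun_prop
    simpa only [sub_eq_add_neg] using hf.add (hc.upperSemicontinuous.upperSemicontinuousOn A)
  obtain ⟨T₁, T₂, h₁, h₂, hT⟩ := exists_isLimitingSuperjet_of_add_le (a := a) (b := b) hK hK'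
    (hsub (q := p) (c := a) hu) (hsub (q := -p) (c := b) hv) ha hb hσ fun x hx y hy => by
      have hsq : ‖x - y - (a - b)‖ ^ 2 =
          ‖x - y‖ ^ 2 - 2 * ⟪a - b, x - y - (a - b)⟫ - ‖a - b‖ ^ 2 := by
        rw [norm_sub_sq_real (x - y), inner_sub_right (a - b), real_inner_self_eq_norm_sq,
          real_inner_comm (a - b)]
        ring
      have hlin : ⟪p, x - a⟫ + ⟪-p, y - b⟫ = σ * ⟪a - b, x - y - (a - b)⟫ := by
        rw [inner_neg_left, ← sub_eq_add_neg, ← inner_sub_right, hp, real_inner_smul_left]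
        congr 2
        abel
      simp only [sub_self, inner_zero_right, sub_zero]
      rw [hsq]
      linarith [hmax x hx y hy]
  exact ⟨T₁, T₂, by simpa using h₁.add_inner, by simpa using h₂.add_inner, hT⟩

end TheoremOnSums

section Hessian

section IsSelfAdjoint

variable {E : Type*} [NormedAddCommGroup E] [InnerProductSpace ℝ E] [CompleteSpace E]

lemma isSelfAdjoint_smul_one (c : ℝ) : IsSelfAdjoint (c • (1 : E →L[ℝ] E)) :=
  (IsSelfAdjoint.all c).smul (.one _)

lemma isSelfAdjoint_add_smul_one {T : E →L[ℝ] E} (hT : IsSelfAdjoint T) (c : ℝ) :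
    IsSelfAdjoint (T + c • 1) :=
  hT.add (isSelfAdjoint_smul_one c)

end IsSelfAdjoint

variable {N : ℕ} {φ ψ : Space N → ℝ} {x : Space N}

/-- The matrix of an operator on `ℝᴺ` in the standard basis. -/
noncomputable abbrev matrixOf : (Space N →L[ℝ] Space N) ≃⋆ₐ[ℝ] Mat N :=
  (Matrix.toEuclideanCLM (n := Fin N) (𝕜 := ℝ)).symm

lemma matrixOf_apply (T : Space N →L[ℝ] Space N) (i j : Fin N) :
    matrixOf T i j = T (EuclideanSpace.single j 1) i := by
  have h := congrArg (· i) (Matrix.ofLp_toEuclideanCLM (matrixOf T) (EuclideanSpace.single j 1))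
  simpa using h.symm

lemma dotProduct_matrixOf_mulVec (T : Space N →L[ℝ] Space N) (h k : Fin N → ℝ) :
    h ⬝ᵥ matrixOf T *ᵥ k = ⟪T (WithLp.toLp 2 k), WithLp.toLp 2 h⟫ := by
  have e := Matrix.inner_toEuclideanCLM (matrixOf T) (WithLp.toLp 2 h) (WithLp.toLp 2 k)
  rw [← e, StarAlgEquiv.apply_symm_apply, real_inner_comm]

lemma continuous_matrixOf : Continuous (matrixOf : (Space N →L[ℝ] Space N) → Mat N) :=
  (IsLinearMap.mk' matrixOf ⟨map_add _, map_smul _⟩).continuous_of_finiteDimensional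

lemma isSymm_matrixOf {T : Space N →L[ℝ] Space N} (hT : IsSelfAdjoint T) :
    (matrixOf T).IsSymm := by
  have h : star (matrixOf T) = matrixOf T := hT.map matrixOf
  rwa [Matrix.star_eq_conjTranspose, Matrix.conjTranspose_eq_transpose_of_trivial] at h

lemma posSemidef_matrixOf {T : Space N →L[ℝ] Space N} (hT : IsSelfAdjoint T)
    (h : ∀ k, 0 ≤ ⟪T k, k⟫) : (matrixOf T).PosSemidef :=
  .of_dotProduct_mulVec_nonneg (hT.map matrixOf) fun k => by
    simpa only [star_trivial, dotProduct_matrixOf_mulVec] using h _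

lemma hessian_eq_matrixOf {P : Space N → Space N} {T : Space N →L[ℝ] Space N}
    (hφ : ∀ y, HasGradientAt φ (P y) y) (hP : HasFDerivAt P T x) :
    hessian φ x = matrixOf T := by
  have hf : fderiv ℝ φ = fun y => (InnerProductSpace.toDual ℝ (Space N) (P y)) :=
    funext fun y => (hφ y).hasFDerivAt.fderiv
  ext i j
  have hsymm := (isSymm_matrixOf (isSelfAdjoint_of_hasGradientAt hφ hP)).apply i j
  rw [← hsymm, matrixOf_apply]
  simp only [hessian, Matrix.of_apply, hf, (hasFDerivAt_toDual_comp hP).fderiv]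
  change ⟪T (EuclideanSpace.single i 1), EuclideanSpace.single j 1⟫ = _
  simp [EuclideanSpace.inner_single_right]

lemma hasGradientAt_of_contDiff (hφ : ContDiff ℝ 2 φ) (x : Space N) :
    HasGradientAt φ (gradient φ x) x :=
  (hφ.differentiable two_ne_zero x).hasGradientAt

lemma contDiff_gradient (hφ : ContDiff ℝ 2 φ) : ContDiff ℝ 1 (gradient φ) :=
  (InnerProductSpace.toDual ℝ (Space N)).symm.contDiff.comp
    (hφ.fderiv_right (m := 1) one_add_one_eq_two.le)

lemma hasFDerivAt_gradient (hφ : ContDiff ℝ 2 φ) (x : Space N) :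
    HasFDerivAt (gradient φ) (matrixOf.symm (hessian φ x)) x := by
  have h := ((contDiff_gradient hφ).differentiable one_ne_zero x).hasFDerivAt
  rwa [hessian_eq_matrixOf (hasGradientAt_of_contDiff hφ) h, StarAlgEquiv.symm_apply_apply]

lemma isSymm_hessian (hφ : ContDiff ℝ 2 φ) (x : Space N) : (hessian φ x).IsSymm := by
  simpa only [StarAlgEquiv.apply_symm_apply] using isSymm_matrixOf
    (isSelfAdjoint_of_hasGradientAt (hasGradientAt_of_contDiff hφ) (hasFDerivAt_gradient hφ x))

lemma continuous_hessian (hφ : ContDiff ℝ 2 φ) : Continuous (hessian φ) := by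
  have : Continuous (fderiv ℝ (fderiv ℝ φ)) :=
    (hφ.fderiv_right (m := 1) one_add_one_eq_two.le).continuous_fderiv one_ne_zero
  refine continuous_matrix fun i j => ?_
  simp only [hessian, Matrix.of_apply]
  fun_prop

lemma gradient_add (hφ : ContDiff ℝ 2 φ) (hψ : ContDiff ℝ 2 ψ) (x : Space N) :
    gradient (fun y => φ y + ψ y) x = gradient φ x + gradient ψ x :=
  (hasGradientAt_add (hasGradientAt_of_contDiff hφ x) (hasGradientAt_of_contDiff hψ x)).gradient

lemma hessian_add (hφ : ContDiff ℝ 2 φ) (hψ : ContDiff ℝ 2 ψ) (x : Space N) :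
    hessian (fun y => φ y + ψ y) x = hessian φ x + hessian ψ x := by
  rw [hessian_eq_matrixOf (fun y => hasGradientAt_add (hasGradientAt_of_contDiff hφ y)
    (hasGradientAt_of_contDiff hψ y))
    ((hasFDerivAt_gradient hφ x).add (hasFDerivAt_gradient hψ x)), map_add,
    StarAlgEquiv.apply_symm_apply, StarAlgEquiv.apply_symm_apply]

lemma hasGradientAt_const_mul {p : Space N} (hφ : HasGradientAt φ p x) (c : ℝ) :
    HasGradientAt (fun y => c * φ y) (c • p) x := by
  rw [hasGradientAt_iff_hasFDerivAt, map_smulₛₗ]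
  exact hφ.hasFDerivAt.const_mul c

lemma gradient_const_mul (hφ : ContDiff ℝ 2 φ) (c : ℝ) (x : Space N) :
    gradient (fun y => c * φ y) x = c • gradient φ x :=
  (hasGradientAt_const_mul (hasGradientAt_of_contDiff hφ x) c).gradient

lemma hessian_const_mul (hφ : ContDiff ℝ 2 φ) (c : ℝ) (x : Space N) :
    hessian (fun y => c * φ y) x = c • hessian φ x := by
  rw [hessian_eq_matrixOf (fun y => hasGradientAt_const_mul (hasGradientAt_of_contDiff hφ y) c)
    ((hasFDerivAt_gradient hφ x).const_smul c), map_smul, StarAlgEquiv.apply_symm_apply]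

lemma hessian_const (c : ℝ) (x : Space N) : hessian (fun _ : Space N => c) x = 0 := by
  ext i j
  simp [hessian]

lemma gradient_eq_and_posSemidef_of_isLocalMin (hφ : ContDiff ℝ 2 φ) (hψ : ContDiff ℝ 2 ψ)
    (hmin : IsLocalMin (fun y => φ y - ψ y) x) :
    gradient φ x = gradient ψ x ∧ (hessian φ x - hessian ψ x).PosSemidef := by
  have hgrad : ∀ y, HasGradientAt (fun y => φ y - ψ y) (gradient φ y - gradient ψ y) y := fun y =>
    hasGradientAt_sub (hasGradientAt_of_contDiff hφ y) (hasGradientAt_of_contDiff hψ y)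
  have hhess := (hasFDerivAt_gradient hφ x).sub (hasFDerivAt_gradient hψ x)
  refine ⟨sub_eq_zero.1 (eq_zero_of_isLocalMin (hgrad x) hmin), ?_⟩
  simpa only [map_sub, StarAlgEquiv.apply_symm_apply] using posSemidef_matrixOf
    (isSelfAdjoint_of_hasGradientAt hgrad hhess) (inner_nonneg_of_isLocalMin hgrad hhess hmin)

end Hessian

section QuarticPerturbation

variable {N : ℕ} {φ : Space N → ℝ}

lemma contDiff_norm_sub_pow_four (ξ : Space N) : ContDiff ℝ 2 fun x : Space N => ‖x - ξ‖ ^ 4 := by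
  simp_rw [show 4 = 2 * 2 by rfl, pow_mul]
  exact ((contDiff_id.sub contDiff_const).norm_sq ℝ).pow 2

lemma hasGradientAt_norm_sub_pow_four (ξ x : Space N) :
    HasGradientAt (fun y => ‖y - ξ‖ ^ 4) ((4 * ‖x - ξ‖ ^ 2) • (x - ξ)) x := by
  simp_rw [show 4 = 2 * 2 by rfl, pow_mul]
  rw [hasGradientAt_iff_hasFDerivAt]
  refine ((((hasFDerivAt_id x).sub_const ξ).norm_sq).pow 2).congr_fderiv ?_
  ext y
  simp only [id_eq, Nat.add_one_sub_one, pow_one, nsmul_eq_mul, Nat.cast_ofNat, map_sub,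
    ContinuousLinearMap.comp_id, smul_apply, sub_apply, coe_innerSL_apply, smul_eq_mul, map_smul,
    InnerProductSpace.toDual_apply_apply]
  ring

lemma gradient_norm_sub_pow_four (ξ : Space N) : gradient (fun x => ‖x - ξ‖ ^ 4) ξ = 0 := by
  simpa using (hasGradientAt_norm_sub_pow_four ξ ξ).gradient

lemma hessian_norm_sub_pow_four (ξ : Space N) : hessian (fun x => ‖x - ξ‖ ^ 4) ξ = 0 := by
  have hsub : HasFDerivAt (fun x : Space N => x - ξ) (.id ℝ _) ξ := (hasFDerivAt_id ξ).sub_const ξ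
  have h := (hsub.norm_sq.const_mul 4).smul hsub
  rw [hessian_eq_matrixOf (hasGradientAt_norm_sub_pow_four ξ) h]
  simp

lemma contDiff_add_quartic (hφ : ContDiff ℝ 2 φ) (c : ℝ) (ξ : Space N) :
    ContDiff ℝ 2 fun x => φ x + c * ‖x - ξ‖ ^ 4 :=
  hφ.add (contDiff_const.mul (contDiff_norm_sub_pow_four ξ))

lemma gradient_add_quartic (hφ : ContDiff ℝ 2 φ) (c : ℝ) (ξ : Space N) :
    gradient (fun x => φ x + c * ‖x - ξ‖ ^ 4) ξ = gradient φ ξ := by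
  rw [gradient_add hφ (contDiff_const.mul (contDiff_norm_sub_pow_four ξ)),
    gradient_const_mul (contDiff_norm_sub_pow_four ξ), gradient_norm_sub_pow_four, smul_zero,
    add_zero]

lemma hessian_add_quartic (hφ : ContDiff ℝ 2 φ) (c : ℝ) (ξ : Space N) :
    hessian (fun x => φ x + c * ‖x - ξ‖ ^ 4) ξ = hessian φ ξ := by
  rw [hessian_add hφ (contDiff_const.mul (contDiff_norm_sub_pow_four ξ)),
    hessian_const_mul (contDiff_norm_sub_pow_four ξ), hessian_norm_sub_pow_four, smul_zero,
    add_zero]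

end QuarticPerturbation

section TestFunctionOfSuperjet

variable {E : Type*} [NormedAddCommGroup E]

lemma exists_isMaxOn_sub_quartic {K : Set E} {v : E → ℝ} {ξ : E} (hK : IsCompact K)
    (hv : UpperSemicontinuousOn v K) (hloc : IsLocalMaxOn v K ξ) :
    ∃ C : ℝ, IsMaxOn (fun x => v x - C * ‖x - ξ‖ ^ 4) K ξ := by
  obtain ⟨r, hr, hball⟩ := Metric.mem_nhdsWithin_iff.1 hloc
  obtain ⟨M, hM⟩ := hv.bddAbove_of_isCompact hK
  refine ⟨|M - v ξ| / r ^ 4, fun x hx => ?_⟩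
  suffices v x - |M - v ξ| / r ^ 4 * ‖x - ξ‖ ^ 4 ≤ v ξ by simpa using this
  rcases lt_or_ge ‖x - ξ‖ r with hxr | hxr
  · have hvx : v x ≤ v ξ := hball ⟨mem_ball_iff_norm.2 hxr, hx⟩
    have : 0 ≤ |M - v ξ| / r ^ 4 * ‖x - ξ‖ ^ 4 := by positivity
    linarith
  · have hvx : v x ≤ M := hM (mem_image_of_mem _ hx)
    have : |M - v ξ| ≤ |M - v ξ| / r ^ 4 * ‖x - ξ‖ ^ 4 := by
      calc |M - v ξ| = |M - v ξ| / r ^ 4 * r ^ 4 := by field_simp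
        _ ≤ |M - v ξ| / r ^ 4 * ‖x - ξ‖ ^ 4 := by gcongr
    linarith [le_abs_self (M - v ξ)]

variable [InnerProductSpace ℝ E]

/-- The quadratic polynomial with gradient `p` and second derivative `T` at `ξ`, normalized to
vanish there. -/
noncomputable def quadraticPolynomial (ξ p : E) (T : E →L[ℝ] E) (x : E) : ℝ :=
  ⟪p, x - ξ⟫ + 1 / 2 * ⟪T (x - ξ), x - ξ⟫

lemma contDiff_quadraticPolynomial (ξ p : E) (T : E →L[ℝ] E) :
    ContDiff ℝ 2 (quadraticPolynomial ξ p T) := by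
  unfold quadraticPolynomial
  have h : ContDiff ℝ 2 fun x : E => x - ξ := contDiff_id.sub contDiff_const
  exact (contDiff_const.inner ℝ h).add
    (contDiff_const.mul ((T.contDiff.comp h).inner ℝ h))

lemma hasGradientAt_quadraticPolynomial [CompleteSpace E] (ξ p : E) {T : E →L[ℝ] E}
    (hT : IsSelfAdjoint T) (x : E) :
    HasGradientAt (quadraticPolynomial ξ p T) (p + T (x - ξ)) x := by
  refine hasGradientAt_add (hasGradientAt_inner_sub p ξ x) ?_
  have h : HasFDerivAt (fun x : E => x - ξ) (.id ℝ _) x := (hasFDerivAt_id x).sub_const ξ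
  refine (((T.hasFDerivAt.comp x h).inner ℝ h).const_mul (1 / 2 : ℝ)).congr_fderiv ?_
  ext k
  have hk : ⟪T k, x - ξ⟫ = ⟪T (x - ξ), k⟫ := by
    rw [← real_inner_comm]
    exact ContinuousLinearMap.isSelfAdjoint_iff_isSymmetric.1 hT (x - ξ) k |>.symm
  simp only [fderivInnerCLM_apply, _root_.smul_apply, ContinuousLinearMap.comp_apply, hk,
    ContinuousLinearMap.prod_apply, ContinuousLinearMap.id_apply, smul_eq_mul, Function.comp_apply,
    InnerProductSpace.toDual_apply_apply]
  ring

end TestFunctionOfSuperjet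

section JetClosure

variable {N : ℕ} {O K : Set (Space N)} {F : Operator N} {u : Space N → ℝ}

lemma IsSuperjet.exists_isMaxOn_sub {ξ p : Space N} {T : Space N →L[ℝ] Space N}
    (h : IsSuperjet u K ξ p T) (hK : IsCompact K) (hu : UpperSemicontinuousOn u K) {ε : ℝ}
    (hε : 0 < ε) :
    ∃ φ : Space N → ℝ, ContDiff ℝ 2 φ ∧ IsMaxOn (fun x => u x - φ x) K ξ ∧
      gradient φ ξ = p ∧ hessian φ ξ = matrixOf (T + ε • 1) := by
  obtain ⟨-, hT, hjet⟩ := h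
  set Q := quadraticPolynomial ξ p (T + ε • 1)
  have hQ : ContDiff ℝ 2 Q := contDiff_quadraticPolynomial ξ p _
  have hQξ : Q ξ = 0 := by simp [Q, quadraticPolynomial]
  have hgrad := hasGradientAt_quadraticPolynomial ξ p (isSelfAdjoint_add_smul_one hT ε)
  have hhess : HasFDerivAt (fun x => p + (T + ε • 1) (x - ξ)) (T + ε • 1) ξ :=
    ((T + ε • 1).hasFDerivAt.comp ξ ((hasFDerivAt_id ξ).sub_const ξ)).const_add p
  have hloc : IsLocalMaxOn (fun x => u x - Q x) K ξ := by
    filter_upwards [hjet (ε / 2) (half_pos hε)] with x hx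
    simp only [hQξ, Q, quadraticPolynomial, _root_.add_apply, _root_.smul_apply,
      one_apply_eq_self, inner_add_left, inner_smul_left, real_inner_self_eq_norm_sq,
      RCLike.conj_to_real]
    linarith
  obtain ⟨C, hC⟩ := exists_isMaxOn_sub_quartic hK
    (hu.add hQ.continuous.neg.continuousOn.upperSemicontinuousOn) hloc
  refine ⟨fun x => Q x + C * ‖x - ξ‖ ^ 4, contDiff_add_quartic hQ C ξ, ?_, ?_, ?_⟩
  · simpa only [sub_add_eq_sub_sub, Pi.neg_apply, ← sub_eq_add_neg] using hC
  · rw [gradient_add_quartic hQ, (hgrad ξ).gradient, sub_self, map_zero, add_zero]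
  · rw [hessian_add_quartic hQ, hessian_eq_matrixOf hgrad hhess]

lemma IsContinuousOperator.tendsto (hF : IsContinuousOperator O F) {ι : Type*} {f : Filter ι}
    {x p : Space N} {r : ℝ} {X : Mat N} {xs ps : ι → Space N} {rs : ι → ℝ} {Xs : ι → Mat N}
    (hxO : x ∈ O) (hX : X.IsSymm) (hx : Tendsto xs f (𝓝 x)) (hr : Tendsto rs f (𝓝 r))
    (hp : Tendsto ps f (𝓝 p)) (hXs : Tendsto Xs f (𝓝 X)) (hO : ∀ᶠ i in f, xs i ∈ O)
    (hsymm : ∀ᶠ i in f, (Xs i).IsSymm) :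
    Tendsto (fun i => F (xs i) (rs i) (ps i) (Xs i)) f (𝓝 (F x r p X)) :=
  (hF (x, r, p, X) ⟨hxO, hX⟩).tendsto.comp (tendsto_nhdsWithin_iff.2
    ⟨hx.prodMk_nhds (hr.prodMk_nhds (hp.prodMk_nhds hXs)), hO.and hsymm⟩)

lemma IsLimitingSuperjet.operator_nonpos (hF : IsContinuousOperator O F) (hKO : K ⊆ O)
    (hK : IsCompact K) (hu : UpperSemicontinuousOn u K) {x p : Space N}
    {T : Space N →L[ℝ] Space N} (h : IsLimitingSuperjet u K x p T) (hx : x ∈ K)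
    (htest : ∀ᶠ j in 𝓝 (x, u x), j.1 ∈ K → u j.1 = j.2 → ∀ φ : Space N → ℝ, ContDiff ℝ 2 φ →
      IsMaxOn (fun y => u y - φ y) K j.1 → F j.1 (u j.1) (gradient φ j.1) (hessian φ j.1) ≤ 0) :
    F x (u x) p (matrixOf T) ≤ 0 := by
  have hT := h.isSelfAdjoint
  suffices hε : ∀ ε : ℝ, 0 < ε → F x (u x) p (matrixOf (T + ε • 1)) ≤ 0 by
    refine le_of_tendsto (hF.tendsto (f := 𝓝[>] (0 : ℝ)) (hKO hx) (isSymm_matrixOf hT)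
      tendsto_const_nhds tendsto_const_nhds tendsto_const_nhds ?_ (.of_forall fun _ => hKO hx)
      (.of_forall fun ε => isSymm_matrixOf (isSelfAdjoint_add_smul_one hT ε)))
      (eventually_mem_nhdsWithin.mono hε)
    have : Continuous fun ε : ℝ => matrixOf (T + ε • 1) := continuous_matrixOf.comp (by fun_prop)
    exact (this.tendsto' 0 _ (by simp)).mono_left nhdsWithin_le_nhds
  intro ε hε
  set l := 𝓝[superjetGraph u K] (x, u x, p, T)
  have : l.NeBot := mem_closure_iff_nhdsWithin_neBot.1 h
  have hmem : ∀ᶠ j in l, j ∈ superjetGraph u K := self_mem_nhdsWithin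
  have hlim : Tendsto id l (𝓝 (x, u x, p, T)) := nhdsWithin_le_nhds
  have hlimT : Tendsto (fun j => matrixOf (j.2.2.2 + ε • 1)) l (𝓝 (matrixOf (T + ε • 1))) :=
    (continuous_matrixOf.tendsto _).comp (hlim.snd_nhds.snd_nhds.snd_nhds.add_const _)
  refine le_of_tendsto (hF.tendsto (hKO hx) (isSymm_matrixOf (isSelfAdjoint_add_smul_one hT ε))
    hlim.fst_nhds hlim.snd_nhds.fst_nhds hlim.snd_nhds.snd_nhds.fst_nhds hlimT
    (hmem.mono fun j hj => hKO hj.2.1)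
    (hmem.mono fun j hj => isSymm_matrixOf (isSelfAdjoint_add_smul_one hj.2.2.1 ε))) ?_
  filter_upwards [hmem, (hlim.fst_nhds.prodMk_nhds hlim.snd_nhds.fst_nhds).eventually htest]
    with j ⟨huj, hj⟩ htest
  obtain ⟨φ, hφ, hmax, hgrad, hhess⟩ := hj.exists_isMaxOn_sub hK hu hε
  simpa only [id_eq, hgrad, hhess, huj] using htest hj.1 huj φ hφ hmax

end JetClosure

section DoublingIneq

variable {N : ℕ}

lemma posSemidef_fromBlocks_matrixOf {A B D : Space N →L[ℝ] Space N} (hA : IsSelfAdjoint A)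
    (hB : IsSelfAdjoint B) (hD : IsSelfAdjoint D)
    (h : ∀ k l, 0 ≤ ⟪A k, k⟫ + 2 * ⟪B k, l⟫ + ⟪D l, l⟫) :
    (Matrix.fromBlocks (matrixOf A) (matrixOf B) (matrixOf B) (matrixOf D)).PosSemidef := by
  refine .of_dotProduct_mulVec_nonneg ?_ fun k => ?_
  · rw [Matrix.IsHermitian, Matrix.conjTranspose_eq_transpose_of_trivial]
    exact (isSymm_matrixOf hA).fromBlocks (isSymm_matrixOf hB) (isSymm_matrixOf hD)
  · rw [← Sum.elim_comp_inl_inr k, star_trivial, Matrix.fromBlocks_mulVec,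
      sumElim_dotProduct_sumElim]
    simp only [Sum.elim_comp_inl, Sum.elim_comp_inr, dotProduct_add, dotProduct_matrixOf_mulVec]
    have hsymm := ContinuousLinearMap.isSelfAdjoint_iff_isSymmetric.1 hB
      (WithLp.toLp 2 (k ∘ Sum.inr)) (WithLp.toLp 2 (k ∘ Sum.inl))
    have := h (WithLp.toLp 2 (k ∘ Sum.inl)) (WithLp.toLp 2 (k ∘ Sum.inr))
    simp only [ContinuousLinearMap.coe_coe] at hsymm
    rw [real_inner_comm (B _)] at hsymm
    linarith

lemma neg_norm_mul_sq_le_inner {E : Type*} [NormedAddCommGroup E] [InnerProductSpace ℝ E]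
    (T : E →L[ℝ] E) (h : E) : -(‖T‖ * ‖h‖ ^ 2) ≤ ⟪T h, h⟫ := by
  have hTh : ‖T h‖ * ‖h‖ ≤ ‖T‖ * ‖h‖ ^ 2 := by
    rw [sq, ← mul_assoc]
    exact mul_le_mul_of_nonneg_right (T.le_opNorm h) (norm_nonneg h)
  exact neg_le_of_abs_le ((abs_real_inner_le_norm _ _).trans hTh)

lemma doublingIneq_matrixOf {T₁ T₂ : Space N →L[ℝ] Space N} {σ : ℝ} (hT₁ : IsSelfAdjoint T₁)
    (hT₂ : IsSelfAdjoint T₂) (hn₁ : ‖T₁‖ ≤ 3 * σ) (hn₂ : ‖T₂‖ ≤ 3 * σ)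
    (hsum : ∀ h l, ⟪T₁ h, h⟫ + ⟪T₂ l, l⟫ ≤ 3 * σ * ‖h - l‖ ^ 2) :
    DoublingIneq σ (matrixOf T₁) (-matrixOf T₂) := by
  constructor
  · have hlower : ∀ k l, 0 ≤ ⟪(T₁ + (3 * σ) • 1) k, k⟫ +
        2 * ⟪((0 : ℝ) • 1 : Space N →L[ℝ] Space N) k, l⟫ + ⟪(T₂ + (3 * σ) • 1) l, l⟫ :=
        fun k l => by
      have hk := mul_le_mul_of_nonneg_right hn₁ (sq_nonneg ‖k‖)
      have hl := mul_le_mul_of_nonneg_right hn₂ (sq_nonneg ‖l‖)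
      simp only [_root_.add_apply, _root_.smul_apply, one_apply_eq_self, inner_add_left,
        inner_smul_left, real_inner_self_eq_norm_sq, RCLike.conj_to_real]
      linarith [neg_norm_mul_sq_le_inner T₁ k, neg_norm_mul_sq_le_inner T₂ l]
    convert posSemidef_fromBlocks_matrixOf (isSelfAdjoint_add_smul_one hT₁ _)
      (isSelfAdjoint_smul_one 0) (isSelfAdjoint_add_smul_one hT₂ _) hlower using 1
    simp [sub_eq_add_neg, -Matrix.fromBlocks_one, Matrix.fromBlocks_smul, Matrix.fromBlocks_add]
  · have hupper : ∀ k l, 0 ≤ ⟪(-T₁ + (3 * σ) • 1) k, k⟫ +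
        2 * ⟪((-(3 * σ)) • 1 : Space N →L[ℝ] Space N) k, l⟫ + ⟪(-T₂ + (3 * σ) • 1) l, l⟫ :=
        fun k l => by
      have hkl := hsum k l
      rw [norm_sub_sq_real] at hkl
      simp only [_root_.add_apply, _root_.neg_apply, _root_.smul_apply, one_apply_eq_self,
        inner_add_left, inner_neg_left, inner_smul_left, real_inner_self_eq_norm_sq,
        RCLike.conj_to_real]
      linarith
    convert posSemidef_fromBlocks_matrixOf (isSelfAdjoint_add_smul_one hT₁.neg _)
      (isSelfAdjoint_smul_one _) (isSelfAdjoint_add_smul_one hT₂.neg _) hupper using 1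
    simp [add_comm, sub_eq_add_neg, Matrix.fromBlocks_smul, Matrix.fromBlocks_add,
      Matrix.fromBlocks_neg]

end DoublingIneq

section DoublingSequence

lemma tendsto_of_add_nonneg {ι : Type*} {f : Filter ι} {s t : ι → ℝ} {A B : ℝ}
    (hs : ∀ y, A < y → ∀ᶠ i in f, s i < y) (ht : ∀ y, B < y → ∀ᶠ i in f, t i < y)
    (hst : ∀ i, 0 ≤ s i + t i) (hAB : A + B ≤ 0) : Tendsto s f (𝓝 A) := by
  refine tendsto_order.2 ⟨fun y hy => ?_, hs⟩
  filter_upwards [ht (-y) (by linarith)] with i hi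
  linarith [hst i]

lemma tendsto_norm_zero_of_penalization {E : Type*} [SeminormedAddCommGroup E] {ι : Type*}
    {f : Filter ι} {σ : ι → ℝ} {d : ι → E} {M : ℝ} (hσ : Tendsto σ f atTop) (hσ0 : ∀ i, 0 < σ i)
    (hd : ∀ i, σ i / 2 * ‖d i‖ ^ 2 ≤ M) : Tendsto (fun i => ‖d i‖) f (𝓝 0) := by
  have hsq : Tendsto (fun i => ‖d i‖ ^ 2) f (𝓝 0) := by
    refine squeeze_zero (fun i => sq_nonneg _) (fun i => ?_) (hσ.const_div_atTop (2 * M))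
    rw [le_div_iff₀ (hσ0 i)]
    linarith [hd i]
  simpa using hsq.sqrt

variable {E : Type*} [SeminormedAddCommGroup E] {K K' : Set E} {u v : E → ℝ}

lemma upperSemicontinuousOn_fst_add_snd (hu : UpperSemicontinuousOn u K)
    (hv : UpperSemicontinuousOn v K') :
    UpperSemicontinuousOn (fun w : E × E => u w.1 + v w.2) (K ×ˢ K') := by
  have hfst : UpperSemicontinuousOn (fun w : E × E => u w.1) (K ×ˢ K') := fun w hw y hy =>
    (continuous_fst.continuousWithinAt.tendsto_nhdsWithin fun _ h => h.1).eventually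
      (hu w.1 hw.1 y hy)
  have hsnd : UpperSemicontinuousOn (fun w : E × E => v w.2) (K ×ˢ K') := fun w hw y hy =>
    (continuous_snd.continuousWithinAt.tendsto_nhdsWithin fun _ h => h.2).eventually
      (hv w.2 hw.2 y hy)
  exact hfst.add hsnd

lemma exists_isMax_doubling (hK : IsCompact K) (hK' : IsCompact K') (hne : K.Nonempty)
    (hne' : K'.Nonempty) (hu : UpperSemicontinuousOn u K) (hv : UpperSemicontinuousOn v K')
    (σ : ℝ) : ∃ a ∈ K, ∃ b ∈ K', ∀ x ∈ K, ∀ y ∈ K',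
      u x + v y - σ / 2 * ‖x - y‖ ^ 2 ≤ u a + v b - σ / 2 * ‖a - b‖ ^ 2 := by
  have hpen : Continuous fun w : E × E => -(σ / 2 * ‖w.1 - w.2‖ ^ 2) := by fun_prop
  obtain ⟨⟨a, b⟩, ⟨ha, hb⟩, hmax⟩ := UpperSemicontinuousOn.exists_isMaxOn (hne.prod hne')
    (hK.prod hK') ((upperSemicontinuousOn_fst_add_snd hu hv).add
      hpen.continuousOn.upperSemicontinuousOn)
  exact ⟨a, ha, b, hb, fun x hx y hy => by
    simpa [sub_eq_add_neg] using hmax (⟨hx, hy⟩ : (x, y) ∈ K ×ˢ K')⟩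

lemma tendsto_of_doubling (hK : IsCompact K) (hK' : IsCompact K')
    (hu : UpperSemicontinuousOn u K) (hv : UpperSemicontinuousOn v K') {a b : ℕ → E} {σ : ℕ → ℝ}
    {z : E} (ha : ∀ n, a n ∈ K) (hb : ∀ n, b n ∈ K') (hσ0 : ∀ n, 0 < σ n)
    (hσ : Tendsto σ atTop atTop) (hpen : ∀ n, σ n / 2 * ‖a n - b n‖ ^ 2 ≤ u (a n) + v (b n))
    (hz : z ∈ K) (hz' : z ∈ K') (hle : u z + v z ≤ 0) (haz : Tendsto a atTop (𝓝 z)) :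
    Tendsto b atTop (𝓝 z) ∧ Tendsto (fun n => u (a n)) atTop (𝓝 (u z)) ∧
      Tendsto (fun n => v (b n)) atTop (𝓝 (v z)) ∧ u z + v z = 0 ∧
      Tendsto (fun n => σ n * ‖a n - b n‖ ^ 2 + ‖a n - b n‖) atTop (𝓝 0) := by
  have hsum : ∀ n, 0 ≤ u (a n) + v (b n) := fun n =>
    (mul_nonneg (half_pos (hσ0 n)).le (sq_nonneg _)).trans (hpen n)
  obtain ⟨M, hM⟩ := hu.bddAbove_of_isCompact hK
  obtain ⟨M', hM'⟩ := hv.bddAbove_of_isCompact hK'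
  have hdist : Tendsto (fun n => ‖a n - b n‖) atTop (𝓝 0) :=
    tendsto_norm_zero_of_penalization hσ hσ0 (M := M + M') fun n => (hpen n).trans
      (add_le_add (hM (mem_image_of_mem u (ha n))) (hM' (mem_image_of_mem v (hb n))))
  have hbz : Tendsto b atTop (𝓝 z) := by
    simpa using haz.sub (tendsto_zero_iff_norm_tendsto_zero.2 hdist)
  have hua := fun y hy => (tendsto_nhdsWithin_iff.2 ⟨haz, .of_forall ha⟩).eventually (hu z hz y hy)
  have hvb := fun y hy => (tendsto_nhdsWithin_iff.2 ⟨hbz, .of_forall hb⟩).eventually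
    (hv z hz' y hy)
  have hua' := tendsto_of_add_nonneg hua hvb hsum hle
  have hvb' := tendsto_of_add_nonneg hvb hua (fun n => by linarith [hsum n]) (by linarith)
  have hz0 : u z + v z = 0 := le_antisymm hle (ge_of_tendsto' (hua'.add hvb') hsum)
  have hpen0 : Tendsto (fun n => σ n * ‖a n - b n‖ ^ 2) atTop (𝓝 0) := by
    have hlim := (hua'.add hvb').const_mul 2
    rw [hz0, mul_zero] at hlim
    exact squeeze_zero (fun n => mul_nonneg (hσ0 n).le (sq_nonneg _))
      (fun n => by linarith [hpen n]) hlim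
  exact ⟨hbz, hua', hvb', hz0, by simpa using hpen0.add hdist⟩

lemma exists_doubling_sequence (hK : IsCompact K) (hK' : IsCompact K') (hKK' : K ⊆ K')
    (hu : UpperSemicontinuousOn u K) (hv : UpperSemicontinuousOn v K')
    (hle : ∀ x ∈ K, u x + v x ≤ 0) {x₀ : E} (hx₀ : x₀ ∈ K) (heq : u x₀ + v x₀ = 0) :
    ∃ (a b : ℕ → E) (σ : ℕ → ℝ) (z : E), (∀ n, a n ∈ K ∧ b n ∈ K' ∧ 0 < σ n ∧
      ∀ x ∈ K, ∀ y ∈ K', u x + v y - σ n / 2 * ‖x - y‖ ^ 2 ≤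
        u (a n) + v (b n) - σ n / 2 * ‖a n - b n‖ ^ 2) ∧
      z ∈ K ∧ u z + v z = 0 ∧ Tendsto b atTop (𝓝 z) ∧
      Tendsto (fun n => u (a n)) atTop (𝓝 (u z)) ∧ Tendsto (fun n => v (b n)) atTop (𝓝 (v z)) ∧
      Tendsto (fun n => σ n * ‖a n - b n‖ ^ 2 + ‖a n - b n‖) atTop (𝓝 0) := by
  choose a ha b hb hmax using fun n : ℕ =>
    exists_isMax_doubling hK hK' ⟨x₀, hx₀⟩ ⟨x₀, hKK' hx₀⟩ hu hv ((n : ℝ) + 1)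
  obtain ⟨z, hz, s, hs, haz⟩ := hK.tendsto_subseq ha
  have hσ : Tendsto (fun n => (s n : ℝ) + 1) atTop atTop :=
    tendsto_atTop_add_const_right _ _ (tendsto_natCast_atTop_atTop.comp hs.tendsto_atTop)
  have hpen : ∀ n : ℕ, ((n : ℝ) + 1) / 2 * ‖a n - b n‖ ^ 2 ≤ u (a n) + v (b n) := fun n => by
    have := hmax n x₀ hx₀ x₀ (hKK' hx₀)
    rw [heq, sub_self, norm_zero] at this
    linarith
  obtain ⟨hbz, hua, hvb, hz0, hpen0⟩ := tendsto_of_doubling hK hK' hu hv (fun n => ha (s n))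
    (fun n => hb (s n)) (fun n => by positivity) hσ (fun n => hpen (s n)) hz (hKK' hz)
    (hle z hz) haz
  exact ⟨a ∘ s, b ∘ s, fun n => s n + 1, z,
    fun n => ⟨ha _, hb _, by positivity, hmax (s n)⟩, hz, hz0, hbz, hua, hvb, hpen0⟩

end DoublingSequence

section Operators

variable {N : ℕ} {O U K Ω : Set (Space N)} {F G : Operator N} {α l : ℝ} {φ u : Space N → ℝ}

/-- The operator `F[·] - l (·)^α` whose supersolutions enter the definition of `μ₁`. -/
noncomputable def shiftedOperator (F : Operator N) (l α : ℝ) : Operator N :=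
  fun x r p X => F x r p X - l * r ^ α

lemma IsContinuousOperator.shiftedOperator (hF : IsContinuousOperator O F) (l : ℝ) (hα : 0 < α) :
    IsContinuousOperator O (shiftedOperator F l α) := by
  have hpow : Continuous fun q : Space N × ℝ × Space N × Mat N => l * q.2.1 ^ α :=
    continuous_const.mul ((Real.continuous_rpow_const hα.le).comp (by fun_prop))
  exact ContinuousOn.sub hF hpow.continuousOn

/-- The operator of the equation solved by `-φ` when `φ` solves that of `G`; it exchanges
supersolutions and subsolutions. -/
def reflectedOperator (G : Operator N) : Operator N :=
  fun x r p X => -G x (-r) (-p) (-X)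

lemma IsContinuousOperator.reflectedOperator (hG : IsContinuousOperator O G) :
    IsContinuousOperator O (reflectedOperator G) := by
  have hneg : Continuous fun q : Space N × ℝ × Space N × Mat N =>
      (q.1, -q.2.1, -q.2.2.1, -q.2.2.2) := by fun_prop
  exact (hG.comp hneg.continuousOn fun q hq => ⟨hq.1, hq.2.neg⟩).neg

lemma IsSupersolution.reflectedOperator_nonpos (h : IsSupersolution G U φ) {χ : Space N → ℝ}
    (hχ : ContDiff ℝ 2 χ) {ξ : Space N} (hξ : ξ ∈ U) (hK : K ∈ 𝓝 ξ)
    (hmax : IsMaxOn (fun x => -φ x - χ x) K ξ) :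
    reflectedOperator G ξ (-φ ξ) (gradient χ ξ) (hessian χ ξ) ≤ 0 := by
  have hmin : IsLocalMin (fun x => φ x - (-1) * χ x) ξ := by
    filter_upwards [hK] with x hx
    have := hmax hx
    simp only [mem_ofPred_eq] at this
    linarith
  have hG := h _ (contDiff_const.mul hχ) ξ hξ hmin
  rw [gradient_const_mul hχ, hessian_const_mul hχ, neg_one_smul, neg_one_smul] at hG
  simpa [reflectedOperator] using hG

lemma IsSupersolution.const_mul (hF : IsPosHomogeneous O F α) (hUO : U ⊆ O)
    (hpos : ∀ x ∈ U, 0 < φ x) (h : IsSupersolution (shiftedOperator F l α) U φ) {t : ℝ}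
    (ht : 0 < t) : IsSupersolution (shiftedOperator F l α) U fun x => t * φ x := by
  intro ψ hψ ξ hξ hmin
  have hmin' : IsLocalMin (fun x => φ x - t⁻¹ * ψ x) ξ := by
    have hscale : ∀ y, φ y - t⁻¹ * ψ y = t⁻¹ * (t * φ y - ψ y) := fun y => by field_simp
    filter_upwards [hmin] with x hx
    rw [hscale, hscale]
    gcongr
  have hφξ := h _ (contDiff_const.mul hψ) ξ hξ hmin'
  have hhom := hF ξ (hUO hξ) (φ ξ) (t⁻¹ • gradient ψ ξ) (t⁻¹ • hessian ψ ξ)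
    ((isSymm_hessian hψ ξ).smul _) t ht.le
  rw [smul_inv_smul₀ ht.ne', smul_inv_smul₀ ht.ne'] at hhom
  rw [gradient_const_mul hψ, hessian_const_mul hψ] at hφξ
  calc 0 ≤ t ^ α * shiftedOperator F l α ξ (φ ξ) (t⁻¹ • gradient ψ ξ) (t⁻¹ • hessian ψ ξ) :=
        mul_nonneg (Real.rpow_nonneg ht.le α) hφξ
    _ = shiftedOperator F l α ξ (t * φ ξ) (gradient ψ ξ) (hessian ψ ξ) := by
        simp only [shiftedOperator, hhom, Real.mul_rpow ht.le (hpos ξ hξ).le]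
        ring

lemma IsDirichletSubsolution.operator_nonpos (h : IsDirichletSubsolution F Ω u)
    (hφ : ContDiff ℝ 2 φ) {ξ : Space N} (hξ : ξ ∈ closure Ω)
    (hmax : IsMaxOn (fun x => u x - φ x) (closure Ω) ξ) (hu : 0 < u ξ) :
    F ξ (u ξ) (gradient φ ξ) (hessian φ ξ) ≤ 0 := by
  obtain ⟨hint, hbdry⟩ := h φ hφ ξ hξ hmax
  by_cases hξΩ : ξ ∈ Ω
  · exact hint hξΩ
  · exact (min_le_iff.1 (hbdry ⟨hξ, fun hi => hξΩ (interior_subset hi)⟩)).resolve_left hu.not_ge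

end Operators

section TouchingMultiple

variable {X : Type*} [TopologicalSpace X] {K : Set X} {u φ : X → ℝ}

lemma upperSemicontinuousOn_posPart_div (hu : UpperSemicontinuousOn u K)
    (hφ : LowerSemicontinuousOn φ K) (hpos : ∀ x ∈ K, 0 < φ x) :
    UpperSemicontinuousOn (fun x => max (u x) 0 / φ x) K := by
  intro x hx y hy
  have hcont : ContinuousAt (fun s : ℝ => (max (u x) 0 + s) / (φ x - s)) 0 := by
    have : φ x - 0 ≠ 0 := by simpa using (hpos x hx).ne'
    fun_prop (disch := exact this)
  have hlt : ∀ᶠ s in 𝓝[>] (0 : ℝ), (max (u x) 0 + s) / (φ x - s) < y :=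
    (hcont.eventually_lt_const (by simpa using hy)).filter_mono nhdsWithin_le_nhds
  obtain ⟨s, ⟨hsy, hsφ⟩, hs⟩ := ((hlt.and ((eventually_lt_nhds (hpos x hx)).filter_mono
    nhdsWithin_le_nhds)).and self_mem_nhdsWithin).exists
  have hmax : 0 ≤ max (u x) 0 := le_max_right _ _
  filter_upwards [hu x hx (max (u x) 0 + s) (by linarith [le_max_left (u x) 0]),
    hφ x hx (φ x - s) (by linarith)] with w huw hφw
  refine lt_of_le_of_lt ?_ hsy
  exact div_le_div₀ (by linarith) (max_le huw.le (by linarith)) (by linarith) hφw.le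

lemma exists_touching_multiple (hK : IsCompact K) (hu : UpperSemicontinuousOn u K)
    (hφ : LowerSemicontinuousOn φ K) (hpos : ∀ x ∈ K, 0 < φ x) {x₁ : X} (hx₁ : x₁ ∈ K)
    (hux₁ : 0 < u x₁) : ∃ t > 0, (∀ x ∈ K, u x ≤ t * φ x) ∧ ∃ x₀ ∈ K, u x₀ = t * φ x₀ := by
  obtain ⟨x₀, hx₀, hmax⟩ := UpperSemicontinuousOn.exists_isMaxOn ⟨x₁, hx₁⟩ hK
    (upperSemicontinuousOn_posPart_div hu hφ hpos)
  have ht : 0 < max (u x₀) 0 / φ x₀ :=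
    (div_pos (lt_max_of_lt_left hux₁) (hpos x₁ hx₁)).trans_le (hmax hx₁)
  have hux₀ : 0 < u x₀ := by simpa using (div_pos_iff_of_pos_right (hpos x₀ hx₀)).1 ht
  refine ⟨_, ht, fun x hx => (le_max_left _ _).trans ((div_le_iff₀ (hpos x hx)).1 (hmax hx)), x₀,
    hx₀, ?_⟩
  rw [max_eq_left hux₀.le, div_mul_cancel₀ _ (hpos x₀ hx₀).ne']

end TouchingMultiple

section Comparison

variable {N : ℕ} {O Ω U K : Set (Space N)} {F G : Operator N} {α l : ℝ} {u φ : Space N → ℝ}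

lemma exists_doublingIneq_of_isMax_doubling (hF : IsContinuousOperator O F)
    (hG : IsContinuousOperator O G) (hΩ : IsCompact (closure Ω)) (hΩO : closure Ω ⊆ O)
    (hK : IsCompact K) (hKU : K ⊆ U) (hUO : U ⊆ O) (hu : UpperSemicontinuousOn u (closure Ω))
    (hsub : IsDirichletSubsolution F Ω u) (hφ : LowerSemicontinuousOn φ K)
    (hsup : IsSupersolution G U φ) {a b : Space N} (ha : a ∈ closure Ω) (hua : 0 < u a)
    (hb : K ∈ 𝓝 b) {σ : ℝ} (hσ : 0 < σ) (hmax : ∀ x ∈ closure Ω, ∀ y ∈ K,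
      u x + -φ y - σ / 2 * ‖x - y‖ ^ 2 ≤ u a + -φ b - σ / 2 * ‖a - b‖ ^ 2) :
    ∃ X Y : Mat N, X.IsSymm ∧ Y.IsSymm ∧ DoublingIneq σ X Y ∧
      F a (u a) (σ • (a - b)) X ≤ 0 ∧ 0 ≤ G b (φ b) (σ • (a - b)) Y := by
  have hφ' : UpperSemicontinuousOn (fun x => -φ x) K := hφ.neg
  obtain ⟨T₁, T₂, h₁, h₂, hn₁, hn₂, hsum⟩ := exists_isLimitingSuperjet_of_isMax_doubling hΩ hK hu
    hφ' ha (mem_of_mem_nhds hb) hσ hmax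
  refine ⟨matrixOf T₁, -matrixOf T₂, isSymm_matrixOf h₁.isSelfAdjoint,
    (isSymm_matrixOf h₂.isSelfAdjoint).neg,
    doublingIneq_matrixOf h₁.isSelfAdjoint h₂.isSelfAdjoint hn₁ hn₂ hsum, ?_, ?_⟩
  · refine h₁.operator_nonpos hF hΩO hΩ hu ha ?_
    filter_upwards [continuous_snd.continuousAt.eventually_const_lt hua]
      with j hj hjΩ hju χ hχ hmaxχ
    exact hsub.operator_nonpos hχ hjΩ hmaxχ (hju ▸ hj)
  · have hG' := h₂.operator_nonpos hG.reflectedOperator (hKU.trans hUO) hK hφ' (mem_of_mem_nhds hb)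
      ((continuous_fst.continuousAt.eventually (eventually_mem_nhds_iff.2 hb)).mono
        fun j hj hjK _ χ hχ hmaxχ => hsup.reflectedOperator_nonpos hχ (hKU hjK) hj hmaxχ)
    simpa [reflectedOperator] using hG'

lemma StructureCondition.eventually_sub_lt (h : StructureCondition O F)
    (hr : IsContinuousInValueUniformly O F) {ι : Type*} {f : Filter ι} {a b : ι → Space N}
    {σ s t : ι → ℝ} {r ε : ℝ} (ha : ∀ i, a i ∈ O) (hb : ∀ i, b i ∈ O) (hσ : ∀ i, 0 < σ i)
    (hs : Tendsto s f (𝓝 r)) (ht : Tendsto t f (𝓝 r))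
    (hpen : Tendsto (fun i => σ i * ‖a i - b i‖ ^ 2 + ‖a i - b i‖) f (𝓝 0)) (hε : 0 < ε) :
    ∀ᶠ i in f, ∀ X Y : Mat N, X.IsSymm → Y.IsSymm → DoublingIneq (σ i) X Y →
      F (b i) (t i) (σ i • (a i - b i)) Y - F (a i) (s i) (σ i • (a i - b i)) X < ε := by
  obtain ⟨δ, hδ, hF⟩ := hr r (ε / 3) (by positivity)
  obtain ⟨ω, hω, hω0, hFω⟩ := h (|r| + 1) (by positivity)
  have hωlim : Tendsto (fun i => ω (σ i * ‖a i - b i‖ ^ 2 + ‖a i - b i‖)) f (𝓝 0) := by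
    have h0 := (hω 0 self_mem_Ici).tendsto
    rw [hω0] at h0
    refine h0.comp (tendsto_nhdsWithin_iff.2 ⟨hpen, .of_forall fun i => ?_⟩)
    have := hσ i
    rw [mem_Ici]
    positivity
  filter_upwards [Metric.tendsto_nhds.1 hs δ hδ, Metric.tendsto_nhds.1 ht δ hδ,
    hωlim.eventually_lt_const (show 0 < ε / 3 by positivity)] with i hsi hti hωi X Y hX hY hXY
  have hab := hFω X Y hX hY (σ i) (hσ i) hXY (a i) (ha i) (b i) (hb i) r (by linarith)
  have hFa := abs_lt.1 (hF (s i) hsi (a i) (ha i) (σ i • (a i - b i)) X hX)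
  have hFb := abs_lt.1 (hF (t i) hti (b i) (hb i) (σ i • (a i - b i)) Y hY)
  linarith [hFa.1, hFb.2]

lemma IsDirichletSubsolution.lt_of_le (hα : 0 < α) (hF : IsContinuousOperator O F)
    (hF3 : IsContinuousInValueUniformly O F) (hF4 : StructureCondition O F) (hl : 0 < l)
    (hΩ : IsCompact (closure Ω)) (hU : IsOpen U) (hΩU : closure Ω ⊆ U) (hUO : U ⊆ O)
    (hu : UpperSemicontinuousOn u (closure Ω)) (hsub : IsDirichletSubsolution F Ω u)
    (hφ : LowerSemicontinuousOn φ U) (hpos : ∀ x ∈ U, 0 < φ x)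
    (hsup : IsSupersolution (shiftedOperator F l α) U φ) (hle : ∀ x ∈ closure Ω, u x ≤ φ x)
    {x : Space N} (hx : x ∈ closure Ω) : u x < φ x := by
  refine (hle x hx).lt_of_ne fun heq => ?_
  obtain ⟨ρ, hρ, hρU⟩ := hΩ.exists_cthickening_subset_open hU hΩU
  have hv : UpperSemicontinuousOn (fun y => -φ y) (Metric.cthickening ρ (closure Ω)) :=
    (hφ.mono hρU).neg
  obtain ⟨a, b, σ, z, hmax, hz, hz0, hb, hua, hφb, hpen⟩ := exists_doubling_sequence hΩ
    hΩ.cthickening (Metric.self_subset_cthickening _) hu hv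
    (fun y hy => by linarith [hle y hy]) hx (by linarith)
  have huφ : u z = φ z := by linarith
  have hφz : 0 < φ z := hpos z (hΩU hz)
  have hb_nhds : ∀ᶠ n in atTop, Metric.cthickening ρ (closure Ω) ∈ 𝓝 (b n) :=
    hb.eventually (eventually_mem_nhds_iff.2 (mem_of_superset (Metric.isOpen_thickening.mem_nhds
      (Metric.self_subset_thickening hρ _ hz)) (Metric.thickening_subset_cthickening _ _)))
  have hφb' : Tendsto (fun n => φ (b n)) atTop (𝓝 (φ z)) := by simpa using hφb.neg
  have hua' : Tendsto (fun n => u (a n)) atTop (𝓝 (φ z)) := huφ ▸ hua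
  have hpow : Tendsto (fun n => l * φ (b n) ^ α) atTop (𝓝 (l * φ z ^ α)) :=
    (hφb'.rpow_const (.inr hα.le)).const_mul l
  have hgap : 0 < l * φ z ^ α / 2 := by positivity
  obtain ⟨n, hbn, hdiff, hpown, huan⟩ := (hb_nhds.and ((hF4.eventually_sub_lt hF3
    (fun n => hUO (hΩU (hmax n).1)) (fun n => hUO (hρU (hmax n).2.1)) (fun n => (hmax n).2.2.1)
    hua' hφb' hpen hgap).and ((hpow.eventually_const_lt (half_lt_self (by positivity))).and
      (hua'.eventually_const_lt hφz)))).exists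
  obtain ⟨han, -, hσn, hmaxn⟩ := hmax n
  obtain ⟨X, Y, hX, hY, hXY, hFa, hFb⟩ := exists_doublingIneq_of_isMax_doubling hF
    (hF.shiftedOperator l hα) hΩ (hΩU.trans hUO) hΩ.cthickening hρU hUO hu hsub (hφ.mono hρU) hsup
    han huan hbn hσn hmaxn
  simp only [shiftedOperator] at hFb
  linarith [hdiff X Y hX hY hXY]

theorem maximumPrinciple_of_isSupersolution (hα : 0 < α) (hF : IsContinuousOperator O F)
    (hF2 : IsPosHomogeneous O F α) (hF3 : IsContinuousInValueUniformly O F)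
    (hF4 : StructureCondition O F) (hl : 0 < l) (hΩ : IsCompact (closure Ω)) (hU : IsOpen U)
    (hΩU : closure Ω ⊆ U) (hUO : U ⊆ O) (hφ : LowerSemicontinuousOn φ U) (hpos : ∀ x ∈ U, 0 < φ x)
    (hsup : IsSupersolution (shiftedOperator F l α) U φ) : MaximumPrinciple F Ω := by
  intro u hu hsub x₁ hx₁
  by_contra! hux₁
  obtain ⟨t, ht, hle, x₀, hx₀, heq⟩ := exists_touching_multiple hΩ hu (hφ.mono hΩU)
    (fun x hx => hpos x (hΩU hx)) hx₁ hux₁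
  have htφ : LowerSemicontinuousOn (fun x => t * φ x) U :=
    (continuous_const_mul t).comp_lowerSemicontinuousOn hφ fun _ _ h =>
      mul_le_mul_of_nonneg_left h ht.le
  exact (hsub.lt_of_le hα hF hF3 hF4 hl hΩ hU hΩU hUO hu htφ
    (fun x hx => mul_pos ht (hpos x hx)) (hsup.const_mul hF2 hUO hpos ht) hle hx₀).ne heq

end Comparison

section QuarticTestPoints

variable {E : Type*} [SeminormedAddCommGroup E]

/- The term `‖· - ξ‖ ^ 4` makes `ξ` a strict maximum point in the limit, so that the maximum points
converge to it; being of fourth order, it leaves the second order jet at `ξ` unchanged. -/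
lemma tendsto_of_isMaxOn_sub_quartic {ι : Type*} {f : Filter ι} {φ : E → ℝ} (hφ : Continuous φ)
    {ξ : E} {L : ℝ} {K : ι → Set E} {w : ι → E → ℝ} {x y : ι → E} (hx : ∀ i, x i ∈ K i)
    (hxξ : Tendsto x f (𝓝 ξ)) (hwx : Tendsto (fun i => w i (x i)) f (𝓝 L))
    (hmax : ∀ i, IsMaxOn (fun z => w i z - (φ z + 1 * ‖z - ξ‖ ^ 4)) (K i) (y i))
    (hup : ∀ ε : ℝ, 0 < ε → ∀ᶠ i in f, w i (y i) ≤ φ (y i) - φ ξ + L + ε) :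
    Tendsto y f (𝓝 ξ) ∧ Tendsto (fun i => w i (y i)) f (𝓝 L) := by
  have hlow : ∀ ε : ℝ, 0 < ε →
      ∀ᶠ i in f, L - φ ξ - ε < w i (y i) - (φ (y i) + 1 * ‖y i - ξ‖ ^ 4) := fun ε hε => by
    have hcont : Continuous fun z => φ z + 1 * ‖z - ξ‖ ^ 4 := by fun_prop
    have hlim := hwx.sub (hcont.continuousAt.tendsto.comp hxξ)
    filter_upwards [hlim.eventually_const_lt (show L - φ ξ - ε < L - _ by simpa using hε)] with i hi
    exact hi.trans_le (hmax i (hx i))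
  have hyξ : Tendsto y f (𝓝 ξ) := by
    refine Metric.tendsto_nhds.2 fun ε hε => ?_
    filter_upwards [hlow (ε ^ 4 / 2) (by positivity), hup (ε ^ 4 / 2) (by positivity)] with i hl hu
    rw [dist_eq_norm]
    exact lt_of_pow_lt_pow_left₀ 4 hε.le (by linarith)
  have hφy : Tendsto (fun i => φ (y i)) f (𝓝 (φ ξ)) := (hφ.tendsto ξ).comp hyξ
  refine ⟨hyξ, Metric.tendsto_nhds.2 fun ε hε => ?_⟩
  filter_upwards [hlow (ε / 2) (by positivity), hup (ε / 2) (by positivity),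
    Metric.tendsto_nhds.1 hφy (ε / 2) (by positivity)] with i hl hu hφi
  rw [Real.dist_eq, abs_lt] at *
  have : 0 ≤ ‖y i - ξ‖ ^ 4 := by positivity
  constructor <;> linarith [hφi.1, hφi.2]

end QuarticTestPoints

section Stability

variable {N : ℕ} {O : Set (Space N)} {F : Operator N} {φ : Space N → ℝ} {ξ : Space N} {L : ℝ}

lemma IsContinuousOperator.tendsto_add_quartic (hF : IsContinuousOperator O F)
    (hφ : ContDiff ℝ 2 φ) (c : ℝ) (hξ : ξ ∈ O) {ι : Type*} {f : Filter ι} {y : ι → Space N}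
    {s : ι → ℝ} (hy : Tendsto y f (𝓝 ξ)) (hs : Tendsto s f (𝓝 L)) (hyO : ∀ᶠ i in f, y i ∈ O) :
    Tendsto (fun i => F (y i) (s i) (gradient (fun z => φ z + c * ‖z - ξ‖ ^ 4) (y i))
      (hessian (fun z => φ z + c * ‖z - ξ‖ ^ 4) (y i))) f
      (𝓝 (F ξ L (gradient φ ξ) (hessian φ ξ))) := by
  have hχ := contDiff_add_quartic hφ c ξ
  have hgrad := ((contDiff_gradient hχ).continuous.tendsto ξ).comp hy
  have hhess := ((continuous_hessian hχ).tendsto ξ).comp hy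
  rw [gradient_add_quartic hφ] at hgrad
  rw [hessian_add_quartic hφ] at hhess
  exact hF.tendsto hξ (isSymm_hessian hφ ξ) hy hs hgrad hhess hyO
    (.of_forall fun i => isSymm_hessian hχ _)

lemma IsContinuousOperator.nonpos_of_asymptotic_test (hF : IsContinuousOperator O F)
    (hφ : ContDiff ℝ 2 φ) (hξ : ξ ∈ O) {K : ℕ → Set (Space N)} (hK : ∀ n, IsCompact (K n))
    (hKO : ∀ n, K n ⊆ O) {w : ℕ → Space N → ℝ} (hw : ∀ n, UpperSemicontinuousOn (w n) (K n))
    {x : ℕ → Space N} (hx : ∀ n, x n ∈ K n) (hxξ : Tendsto x atTop (𝓝 ξ))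
    (hwx : Tendsto (fun n => w n (x n)) atTop (𝓝 L))
    (hup : ∀ ε : ℝ, 0 < ε → ∀ᶠ n in atTop, ∀ y ∈ K n, w n y ≤ φ y - φ ξ + L + ε)
    {m e : ℕ → ℝ} {m₀ : ℝ} (hm : Tendsto m atTop (𝓝 m₀)) (hmL : m₀ < L)
    (he : Tendsto e atTop (𝓝 0))
    (htest : ∀ n, ∀ χ : Space N → ℝ, ContDiff ℝ 2 χ → ∀ y ∈ K n,
      IsMaxOn (fun z => w n z - χ z) (K n) y → m n < w n y →
        F y (w n y) (gradient χ y) (hessian χ y) ≤ e n) :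
    F ξ L (gradient φ ξ) (hessian φ ξ) ≤ 0 := by
  have hχ := contDiff_add_quartic hφ 1 ξ
  choose y hy hmax using fun n => UpperSemicontinuousOn.exists_isMaxOn ⟨x n, hx n⟩ (hK n)
    ((hw n).add hχ.continuous.neg.continuousOn.upperSemicontinuousOn)
  replace hmax : ∀ n, IsMaxOn (fun z => w n z - (φ z + 1 * ‖z - ξ‖ ^ 4)) (K n) (y n) := by
    simpa only [Pi.neg_apply, ← sub_eq_add_neg] using hmax
  obtain ⟨hyξ, hwy⟩ := tendsto_of_isMaxOn_sub_quartic hφ.continuous hx hxξ hwx hmax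
    fun ε hε => (hup ε hε).mono fun n hn => hn _ (hy n)
  refine le_of_tendsto_of_tendsto (hF.tendsto_add_quartic hφ 1 hξ hyξ hwy
    (.of_forall fun n => hKO n (hy n))) he ?_
  filter_upwards [hm.eventually_lt hwy hmL] with n hn
  exact htest n _ hχ _ (hy n) (hmax n) hn

end Stability

section RelaxedLimit

variable {X : Type*} [TopologicalSpace X] {K : ℕ → Set X} {w : ℕ → X → ℝ} {x : X} {m M : ℝ}

/-- The filter of pairs `(n, y)` with `n → ∞`, `y → x` and `y ∈ K n`. -/
def relaxedFilter (K : ℕ → Set X) (x : X) : Filter (ℕ × X) :=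
  (atTop ×ˢ 𝓝 x) ⊓ 𝓟 {q | q.2 ∈ K q.1}

/-- The half-relaxed upper limit `lim sup* w n` of Barles and Perthame, for functions `w n` on the
sets `K n`; for a constant sequence it is the upper semicontinuous envelope. -/
noncomputable def relaxedLimsup (K : ℕ → Set X) (w : ℕ → X → ℝ) (x : X) : ℝ :=
  limsup (fun q : ℕ × X => w q.1 q.2) (relaxedFilter K x)

lemma tendsto_relaxedFilter {i : ℕ → ℕ} {y : ℕ → X} (hi : Tendsto i atTop atTop)
    (hy : Tendsto y atTop (𝓝 x)) (hK : ∀ j, y j ∈ K (i j)) :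
    Tendsto (fun j => (i j, y j)) atTop (relaxedFilter K x) :=
  tendsto_inf.2 ⟨hi.prodMk hy, tendsto_principal.2 (.of_forall hK)⟩

lemma eventually_relaxedFilter_mem (K : ℕ → Set X) (x : X) :
    ∀ᶠ q in relaxedFilter K x, q.2 ∈ K q.1 :=
  mem_inf_of_right (mem_principal_self _)

lemma isBoundedUnder_relaxedFilter (hM : ∀ n, ∀ y ∈ K n, w n y ≤ M) (x : X) :
    IsBoundedUnder (· ≤ ·) (relaxedFilter K x) fun q : ℕ × X => w q.1 q.2 :=
  isBoundedUnder_of_eventually_le ((eventually_relaxedFilter_mem K x).mono fun _ hq => hM _ _ hq)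

lemma isCoboundedUnder_relaxedFilter (hm : ∀ n, ∀ y ∈ K n, m ≤ w n y) (hx : ∀ n, x ∈ K n) :
    IsCoboundedUnder (· ≤ ·) (relaxedFilter K x) fun q : ℕ × X => w q.1 q.2 := by
  have := (tendsto_relaxedFilter tendsto_id tendsto_const_nhds hx).neBot
  exact IsBoundedUnder.isCoboundedUnder_le (isBoundedUnder_of_eventually_ge
    ((eventually_relaxedFilter_mem K x).mono fun q hq => hm _ _ hq))

lemma le_relaxedLimsup_of_tendsto (hM : ∀ n, ∀ y ∈ K n, w n y ≤ M) {i : ℕ → ℕ} {y : ℕ → X}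
    (hi : Tendsto i atTop atTop) (hy : Tendsto y atTop (𝓝 x)) (hK : ∀ j, y j ∈ K (i j)) {c : ℝ}
    (hc : ∀ᶠ j in atTop, c ≤ w (i j) (y j)) : c ≤ relaxedLimsup K w x := by
  by_contra! hlt
  obtain ⟨j, hj, hcj⟩ := (((tendsto_relaxedFilter hi hy hK).eventually
    (eventually_lt_of_limsup_lt hlt (isBoundedUnder_relaxedFilter hM x))).and hc).exists
  exact hj.not_ge hcj

lemma le_relaxedLimsup (hm : ∀ n, ∀ y ∈ K n, m ≤ w n y) (hM : ∀ n, ∀ y ∈ K n, w n y ≤ M)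
    (hx : ∀ n, x ∈ K n) : m ≤ relaxedLimsup K w x :=
  le_relaxedLimsup_of_tendsto hM tendsto_id tendsto_const_nhds hx
    (.of_forall fun n => hm n x (hx n))

lemma relaxedLimsup_le (hm : ∀ n, ∀ y ∈ K n, m ≤ w n y) (hM : ∀ n, ∀ y ∈ K n, w n y ≤ M)
    (hx : ∀ n, x ∈ K n) : relaxedLimsup K w x ≤ M :=
  limsup_le_of_le (isCoboundedUnder_relaxedFilter hm hx)
    ((eventually_relaxedFilter_mem K x).mono fun _ hq => hM _ _ hq)

lemma upperSemicontinuousOn_relaxedLimsup {S : Set X} (hm : ∀ n, ∀ y ∈ K n, m ≤ w n y)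
    (hM : ∀ n, ∀ y ∈ K n, w n y ≤ M) (hS : ∀ n, S ⊆ K n) :
    UpperSemicontinuousOn (relaxedLimsup K w) S := by
  intro x _ a ha
  obtain ⟨b, hb, hba⟩ := exists_between ha
  have hlt := eventually_lt_of_limsup_lt hb (isBoundedUnder_relaxedFilter hM x)
  rw [relaxedFilter, eventually_inf_principal] at hlt
  obtain ⟨A, hA, B, hB, hAB⟩ := mem_prod_iff.1 hlt
  filter_upwards [mem_nhdsWithin_of_mem_nhds (eventually_mem_nhds_iff.2 hB), self_mem_nhdsWithin]
    with y hy hyS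
  refine (limsup_le_of_le (isCoboundedUnder_relaxedFilter hm fun n => hS n hyS) ?_).trans_lt hba
  rw [relaxedFilter, eventually_inf_principal]
  filter_upwards [prod_mem_prod hA hy] with q hq hqK
  exact (hAB hq hqK).le

lemma exists_seq_tendsto_relaxedLimsup [FirstCountableTopology X]
    (hm : ∀ n, ∀ y ∈ K n, m ≤ w n y) (hM : ∀ n, ∀ y ∈ K n, w n y ≤ M) (hx : ∀ n, x ∈ K n) :
    ∃ (i : ℕ → ℕ) (y : ℕ → X), Tendsto i atTop atTop ∧ Tendsto y atTop (𝓝 x) ∧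
      (∀ j, y j ∈ K (i j)) ∧
      Tendsto (fun j => w (i j) (y j)) atTop (𝓝 (relaxedLimsup K w x)) := by
  have := (tendsto_relaxedFilter tendsto_id tendsto_const_nhds hx).neBot
  have : (relaxedFilter K x).IsCountablyGenerated := by unfold relaxedFilter; infer_instance
  obtain ⟨q, hwq, hq⟩ := exists_seq_tendsto_limsup
    (isCoboundedUnder_relaxedFilter hm hx) (isBoundedUnder_relaxedFilter hM x)
  obtain ⟨hlim, hmem⟩ := tendsto_inf.1 hq
  obtain ⟨n₀, hn₀⟩ := eventually_atTop.1 (tendsto_principal.1 hmem)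
  have hshift : Tendsto (fun j => j + n₀) atTop atTop := tendsto_add_atTop_nat n₀
  exact ⟨fun j => (q (j + n₀)).1, fun j => (q (j + n₀)).2, (tendsto_fst.comp hlim).comp hshift,
    (tendsto_snd.comp hlim).comp hshift, fun j => hn₀ _ (by omega), hwq.comp hshift⟩

end RelaxedLimit

section ObstacleSubsolution

variable {N : ℕ} {O K : Set (Space N)} {G : Operator N} {m M : ℝ} {w : Space N → ℝ}

/-- Upper semicontinuous functions `w : K → [m, M]` that are viscosity subsolutions of `G[w] = 0`,
up to the boundary of `K`, at the points where they exceed the obstacle `m`. -/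
structure IsObstacleSubsolution (G : Operator N) (K : Set (Space N)) (m M : ℝ)
    (w : Space N → ℝ) : Prop where
  usc : UpperSemicontinuousOn w K
  ge : ∀ x ∈ K, m ≤ w x
  le : ∀ x ∈ K, w x ≤ M
  test : ∀ φ : Space N → ℝ, ContDiff ℝ 2 φ → ∀ ξ ∈ K, IsMaxOn (fun x => w x - φ x) K ξ →
    m < w ξ → G ξ (w ξ) (gradient φ ξ) (hessian φ ξ) ≤ 0

lemma isObstacleSubsolution_const (G : Operator N) (K : Set (Space N)) (h : m ≤ M) :
    IsObstacleSubsolution G K m M fun _ => m where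
  usc := continuousOn_const.upperSemicontinuousOn
  ge _ _ := le_rfl
  le _ _ := h
  test _ _ _ _ _ h := absurd h (lt_irrefl _)

/-- Perron's function: the pointwise supremum of all obstacle subsolutions. -/
noncomputable def perronSup (G : Operator N) (K : Set (Space N)) (m M : ℝ) (x : Space N) : ℝ :=
  ⨆ w : {w // IsObstacleSubsolution G K m M w}, w.1 x

lemma IsObstacleSubsolution.le_perronSup (hw : IsObstacleSubsolution G K m M w) {x : Space N}
    (hx : x ∈ K) : w x ≤ perronSup G K m M x :=
  le_ciSup (f := fun w : {w // IsObstacleSubsolution G K m M w} => w.1 x)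
    ⟨M, forall_mem_range.2 fun w => w.2.le x hx⟩ ⟨w, hw⟩

lemma perronSup_le (hmM : m ≤ M) {x : Space N} (hx : x ∈ K) : perronSup G K m M x ≤ M :=
  have : Nonempty {w // IsObstacleSubsolution G K m M w} :=
    ⟨⟨_, isObstacleSubsolution_const G K hmM⟩⟩
  ciSup_le fun w => w.2.le x hx

lemma exists_isObstacleSubsolution_tendsto (hmM : m ≤ M) {x : ℕ → Space N} (hx : ∀ n, x n ∈ K)
    {L : ℝ} (hlim : Tendsto (fun n => perronSup G K m M (x n)) atTop (𝓝 L)) :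
    ∃ w : ℕ → Space N → ℝ, (∀ n, IsObstacleSubsolution G K m M (w n)) ∧
      Tendsto (fun n => w n (x n)) atTop (𝓝 L) := by
  have : Nonempty {w // IsObstacleSubsolution G K m M w} :=
    ⟨⟨_, isObstacleSubsolution_const G K hmM⟩⟩
  choose w hw using fun n : ℕ => exists_lt_of_lt_ciSup
    (sub_lt_self (perronSup G K m M (x n)) (Nat.one_div_pos_of_nat (n := n)))
  have hlow : Tendsto (fun n : ℕ => perronSup G K m M (x n) - 1 / ((n : ℝ) + 1)) atTop (𝓝 L) := by
    simpa using hlim.sub tendsto_one_div_add_atTop_nhds_zero_nat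
  exact ⟨fun n => (w n).1, fun n => (w n).2, tendsto_of_tendsto_of_tendsto_of_le_of_le hlow hlim
    (fun n => (hw n).le) fun n => (w n).2.le_perronSup (hx n)⟩

theorem exists_greatest_isObstacleSubsolution (hG : IsContinuousOperator O G) (hK : IsCompact K)
    (hKO : K ⊆ O) (hmM : m ≤ M) : ∃ v, IsObstacleSubsolution G K m M v ∧
      ∀ w, IsObstacleSubsolution G K m M w → ∀ x ∈ K, w x ≤ v x := by
  have hge : ∀ _ : ℕ, ∀ x ∈ K, m ≤ perronSup G K m M x := fun _ _ hx =>
    (isObstacleSubsolution_const G K hmM).le_perronSup hx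
  have hle : ∀ _ : ℕ, ∀ x ∈ K, perronSup G K m M x ≤ M := fun _ _ => perronSup_le hmM
  set v := relaxedLimsup (fun _ => K) fun _ => perronSup G K m M
  have hPv : ∀ x ∈ K, perronSup G K m M x ≤ v x := fun x hx =>
    le_relaxedLimsup_of_tendsto hle tendsto_id tendsto_const_nhds (fun _ => hx)
      (.of_forall fun _ => le_rfl)
  refine ⟨v, ⟨upperSemicontinuousOn_relaxedLimsup hge hle fun _ => Subset.rfl,
    fun x hx => le_relaxedLimsup hge hle fun _ => hx,
    fun x hx => relaxedLimsup_le hge hle fun _ => hx, fun φ hφ ξ hξ hmax hmξ => ?_⟩,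
    fun w hw x hx => (hw.le_perronSup hx).trans (hPv x hx)⟩
  obtain ⟨-, x, -, hxξ, hxK, hlim⟩ := exists_seq_tendsto_relaxedLimsup hge hle fun _ => hξ
  obtain ⟨w, hw, hwlim⟩ := exists_isObstacleSubsolution_tendsto hmM hxK hlim
  refine hG.nonpos_of_asymptotic_test hφ (hKO hξ) (fun _ => hK) (fun _ => hKO)
    (fun n => (hw n).usc) hxK hxξ hwlim (fun ε hε => .of_forall fun n y hy => ?_)
    tendsto_const_nhds hmξ tendsto_const_nhds fun n χ hχ y hy hmaxy hmy =>
      (hw n).test χ hχ y hy hmaxy hmy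
  have hvy : v y - φ y ≤ v ξ - φ ξ := hmax hy
  linarith [((hw n).le_perronSup hy).trans (hPv y hy)]

end ObstacleSubsolution

section LscEnvelope

variable {X : Type*} [TopologicalSpace X] {U : Set X} {v : X → ℝ} {x : X} {m M a : ℝ}

/-- The lower semicontinuous envelope `v_*`. -/
noncomputable def lscEnvelope (v : X → ℝ) (x : X) : ℝ := liminf v (𝓝 x)

lemma eventually_lt_of_lt_lscEnvelope (hU : IsOpen U) (hm : ∀ x ∈ U, m ≤ v x) (hx : x ∈ U)
    (ha : a < lscEnvelope v x) : ∀ᶠ y in 𝓝 x, a < v y :=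
  eventually_lt_of_lt_liminf ha (isBoundedUnder_of_eventually_ge ((hU.eventually_mem hx).mono hm))

lemma le_lscEnvelope (hU : IsOpen U) (hM : ∀ x ∈ U, v x ≤ M) (hx : x ∈ U)
    (ha : ∀ᶠ y in 𝓝 x, a ≤ v y) : a ≤ lscEnvelope v x :=
  le_liminf_of_le (IsBoundedUnder.isCoboundedUnder_ge
    (isBoundedUnder_of_eventually_le ((hU.eventually_mem hx).mono hM))) ha

lemma lscEnvelope_le (hU : IsOpen U) (hm : ∀ x ∈ U, m ≤ v x) (hx : x ∈ U) :
    lscEnvelope v x ≤ v x :=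
  le_of_not_gt fun h => (eventually_lt_of_lt_lscEnvelope hU hm hx h).self_of_nhds.false

lemma lowerSemicontinuousOn_lscEnvelope (hU : IsOpen U) (hm : ∀ x ∈ U, m ≤ v x)
    (hM : ∀ x ∈ U, v x ≤ M) : LowerSemicontinuousOn (lscEnvelope v) U := by
  intro x hx a ha
  obtain ⟨b, hab, hb⟩ := exists_between ha
  filter_upwards [mem_nhdsWithin_of_mem_nhds
    (eventually_eventually_nhds.2 (eventually_lt_of_lt_lscEnvelope hU hm hx hb)),
    self_mem_nhdsWithin] with y hy hyU
  exact hab.trans_le (le_lscEnvelope hU hM hyU (hy.mono fun _ h => h.le))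

end LscEnvelope

section GlueMax

variable {X : Type*} {v χ : X → ℝ} {B C K : Set X} {x : X}

open scoped Classical in
/-- The function `max v χ` on `B`, extended by `v`. -/
noncomputable def glueMax (B : Set X) (v χ : X → ℝ) : X → ℝ :=
  B.piecewise (fun x => max (v x) (χ x)) v

lemma glueMax_of_mem (hx : x ∈ B) : glueMax B v χ x = max (v x) (χ x) :=
  if_pos hx

lemma glueMax_of_notMem (hx : x ∉ B) : glueMax B v χ x = v x :=
  if_neg hx

lemma le_glueMax (B : Set X) (v χ : X → ℝ) (x : X) : v x ≤ glueMax B v χ x := by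
  by_cases hx : x ∈ B
  · exact glueMax_of_mem hx ▸ le_max_left _ _
  · exact (glueMax_of_notMem hx).ge

lemma upperSemicontinuousOn_glueMax [TopologicalSpace X] (hv : UpperSemicontinuousOn v K)
    (hχ : Continuous χ) (hB : IsOpen B) (hC : IsClosed C) (hCB : C ⊆ B)
    (hχv : ∀ x ∈ B, x ∉ C → χ x ≤ v x) : UpperSemicontinuousOn (glueMax B v χ) K := by
  intro x hx y hy
  by_cases hxB : x ∈ B
  · rw [glueMax_of_mem hxB, max_lt_iff] at hy
    filter_upwards [hv x hx y hy.1, mem_nhdsWithin_of_mem_nhds (hB.mem_nhds hxB),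
      (hχ.continuousAt.eventually_lt_const hy.2).filter_mono nhdsWithin_le_nhds] with z hvz hzB hχz
    rw [glueMax_of_mem hzB]
    exact max_lt hvz hχz
  · rw [glueMax_of_notMem hxB] at hy
    filter_upwards [hv x hx y hy, mem_nhdsWithin_of_mem_nhds
      (hC.isOpen_compl.mem_nhds fun hxC => hxB (hCB hxC))] with z hvz hzC
    by_cases hzB : z ∈ B
    · rwa [glueMax_of_mem hzB, max_eq_left (hχv z hzB hzC)]
    · rwa [glueMax_of_notMem hzB]

end GlueMax

section Perron

variable {N : ℕ} {O K U : Set (Space N)} {G : Operator N} {m M : ℝ} {v : Space N → ℝ}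

lemma IsDegenerateElliptic.nonpos_of_isLocalMin {φ χ : Space N → ℝ} {ξ : Space N} {r : ℝ}
    (hG : IsDegenerateElliptic O G) (hξ : ξ ∈ O) (hφ : ContDiff ℝ 2 φ) (hχ : ContDiff ℝ 2 χ)
    (hmin : IsLocalMin (fun x => φ x - χ x) ξ) (h : G ξ r (gradient χ ξ) (hessian χ ξ) ≤ 0) :
    G ξ r (gradient φ ξ) (hessian φ ξ) ≤ 0 := by
  obtain ⟨hgrad, hhess⟩ := gradient_eq_and_posSemidef_of_isLocalMin hφ hχ hmin
  have hell := hG ξ hξ r (gradient χ ξ) _ _ (isSymm_hessian hχ ξ) hhess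
  rw [add_sub_cancel] at hell
  rw [hgrad]
  linarith

lemma isObstacleSubsolution_glueMax {χ : Space N → ℝ} {B C : Set (Space N)}
    (hv : IsObstacleSubsolution G K m M v) (hG : IsDegenerateElliptic O G) (hKO : K ⊆ O)
    (hχ : ContDiff ℝ 2 χ) (hB : IsOpen B) (hBK : B ⊆ K) (hC : IsClosed C) (hCB : C ⊆ B)
    (hχM : ∀ x ∈ B, χ x ≤ M)
    (hχG : ∀ x ∈ B, G x (χ x) (gradient χ x) (hessian χ x) ≤ 0)
    (hχv : ∀ x ∈ B, x ∉ C → χ x ≤ v x) : IsObstacleSubsolution G K m M (glueMax B v χ) where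
  usc := upperSemicontinuousOn_glueMax hv.usc hχ.continuous hB hC hCB hχv
  ge x hx := (hv.ge x hx).trans (le_glueMax B v χ x)
  le x hx := by
    by_cases hxB : x ∈ B
    · exact glueMax_of_mem hxB ▸ max_le (hv.le x hx) (hχM x hxB)
    · exact glueMax_of_notMem hxB ▸ hv.le x hx
  test φ hφ x hx hmax hmx := by
    have hmax' : ∀ z ∈ K, glueMax B v χ z - φ z ≤ glueMax B v χ x - φ x :=
      fun z hz => hmax hz
    by_cases hvx : glueMax B v χ x = v x
    · rw [hvx] at hmx hmax' ⊢
      exact hv.test φ hφ x hx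
        (fun z hz => (sub_le_sub_right (le_glueMax B v χ z) _).trans (hmax' z hz)) hmx
    · have hxB : x ∈ B := by_contra fun hxB => hvx (glueMax_of_notMem hxB)
      have hwχ : glueMax B v χ x = χ x := by
        rw [glueMax_of_mem hxB] at hvx ⊢
        exact (max_choice _ _).resolve_left hvx
      rw [hwχ] at hmax' ⊢
      refine hG.nonpos_of_isLocalMin (hKO hx) hφ hχ ?_ (hχG x hxB)
      filter_upwards [hB.mem_nhds hxB] with z hz
      have hχz : χ z ≤ glueMax B v χ z := glueMax_of_mem hz ▸ le_max_right _ _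
      linarith [hmax' z (hBK hz)]

lemma gradient_add_const (φ : Space N → ℝ) (c : ℝ) :
    gradient (fun x => φ x + c) = gradient φ := by
  ext1 x
  simp only [gradient, fderiv_add_const]

lemma hessian_add_const (φ : Space N → ℝ) (c : ℝ) : hessian (fun x => φ x + c) = hessian φ := by
  have h : fderiv ℝ (fun x => φ x + c) = fderiv ℝ φ := funext fun _ => fderiv_add_const c
  ext1 x
  simp only [hessian, h]

/- The subsolution is `ψ - ‖· - ξ‖ ^ 4` lifted to a value slightly above `φ ξ` at `ξ`; the quartic
term lets it fall below `φ` away from `ξ`. -/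
lemma exists_local_subsolution (hG : IsContinuousOperator O G) (hU : IsOpen U) (hUO : U ⊆ O)
    {φ ψ : Space N → ℝ} (hψ : ContDiff ℝ 2 ψ) {ξ : Space N} (hξ : ξ ∈ U)
    (hmin : IsLocalMin (fun x => φ x - ψ x) ξ)
    (hneg : G ξ (φ ξ) (gradient ψ ξ) (hessian ψ ξ) < 0) (hφM : φ ξ < M) :
    ∃ θ : Space N → ℝ, ContDiff ℝ 2 θ ∧ φ ξ < θ ξ ∧ ∃ r > 0, Metric.ball ξ r ⊆ U ∧
      ∀ x ∈ Metric.ball ξ r, θ x ≤ M ∧ G x (θ x) (gradient θ x) (hessian θ x) ≤ 0 ∧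
        (x ∉ Metric.closedBall ξ (r / 2) → θ x ≤ φ x) := by
  set χ : Space N → ℝ := fun x => ψ x + (-1) * ‖x - ξ‖ ^ 4 with hχ
  have hχ2 : ContDiff ℝ 2 χ := contDiff_add_quartic hψ (-1) ξ
  have hlift : Tendsto (fun q : Space N × ℝ => χ q.1 + (φ ξ - ψ ξ + q.2)) (𝓝 ξ ×ˢ 𝓝 0)
      (𝓝 (φ ξ)) := by
    have hcont : Continuous fun q : Space N × ℝ => χ q.1 + (φ ξ - ψ ξ + q.2) :=
      (hχ2.continuous.comp continuous_fst).add (by fun_prop)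
    rw [← nhds_prod_eq]
    exact hcont.tendsto' _ _ (by simp [hχ])
  have hxU : ∀ᶠ q : Space N × ℝ in 𝓝 ξ ×ˢ 𝓝 0, q.1 ∈ U :=
    tendsto_fst.eventually (hU.mem_nhds hξ)
  obtain ⟨p, hp, q, hq, hpq⟩ := eventually_prod_iff.1 ((((hG.tendsto_add_quartic hψ (-1) (hUO hξ)
    tendsto_fst hlift (hxU.mono fun _ h => hUO h)).eventually_lt_const hneg).and
    (hlift.eventually_lt_const hφM)).and (hxU.and (tendsto_fst.eventually hmin)))
  obtain ⟨r, hr, hball⟩ := Metric.eventually_nhds_iff_ball.1 hp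
  obtain ⟨δ, ⟨hqδ, hδr⟩, hδ⟩ := (((hq.and (eventually_lt_nhds
    (show 0 < (r / 2) ^ 4 by positivity))).filter_mono nhdsWithin_le_nhds).and
    (self_mem_nhdsWithin (s := Ioi (0 : ℝ)))).exists
  refine ⟨fun x => χ x + (φ ξ - ψ ξ + δ), hχ2.add contDiff_const, ?_, r, hr,
    fun x hx => (hpq (hball x hx) hqδ).2.1, fun x hx => ?_⟩
  · simp [hχ, ← add_assoc, add_sub_cancel, hδ]
  obtain ⟨⟨hGx, hMx⟩, -, hφψ⟩ := hpq (hball x hx) hqδ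
  rw [gradient_add_const, hessian_add_const]
  refine ⟨hMx.le, hGx.le, fun hxr => ?_⟩
  have hfar : (r / 2) ^ 4 < ‖x - ξ‖ ^ 4 := by
    rw [Metric.mem_closedBall, not_le, dist_eq_norm] at hxr
    gcongr
  simp only [hχ]
  linarith

theorem isSupersolution_lscEnvelope (hG : IsContinuousOperator O G)
    (hG1 : IsDegenerateElliptic O G) (hKO : K ⊆ O) (hU : IsOpen U) (hUK : U ⊆ K)
    (hv : IsObstacleSubsolution G K m M v)
    (hgreatest : ∀ w, IsObstacleSubsolution G K m M w → ∀ x ∈ K, w x ≤ v x)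
    (hlt : ∀ x ∈ U, v x < M) : IsSupersolution G U (lscEnvelope v) := by
  intro ψ hψ ξ hξ hmin
  by_contra! hneg
  have hmU : ∀ x ∈ U, m ≤ v x := fun x hx => hv.ge x (hUK hx)
  obtain ⟨θ, hθ, hθξ, r, hr, hrU, hball⟩ := exists_local_subsolution hG hU (hUK.trans hKO) hψ hξ
    hmin hneg ((lscEnvelope_le hU hmU hξ).trans_lt (hlt ξ hξ))
  have hw := isObstacleSubsolution_glueMax hv hG1 hKO hθ Metric.isOpen_ball (hrU.trans hUK)
    Metric.isClosed_closedBall (Metric.closedBall_subset_ball (half_lt_self hr))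
    (fun x hx => (hball x hx).1) (fun x hx => (hball x hx).2.1)
    fun x hx hxr => ((hball x hx).2.2 hxr).trans (lscEnvelope_le hU hmU (hrU hx))
  have hθv : ∀ x ∈ Metric.ball ξ r, θ x ≤ v x := fun x hx =>
    (le_max_right _ _).trans (glueMax_of_mem hx ▸ hgreatest _ hw x (hUK (hrU hx)))
  obtain ⟨a, ha, haθ⟩ := exists_between hθξ
  refine ha.not_ge (le_lscEnvelope hU (fun x hx => (hlt x hx).le) hξ ?_)
  filter_upwards [hθ.continuous.continuousAt.eventually_const_lt haθ, Metric.ball_mem_nhds ξ hr]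
    with x hax hx
  exact hax.le.trans (hθv x hx)

end Perron

section Thickening

variable {X : Type*} [PseudoMetricSpace X] {S : Set X} {d : ℕ → ℝ}

lemma exists_subseq_tendsto_of_mem_cthickening (hS : IsCompact S) (hd : ∀ n, 0 ≤ d n)
    (hlim : Tendsto d atTop (𝓝 0)) {y : ℕ → X} (hy : ∀ n, y n ∈ Metric.cthickening (d n) S) :
    ∃ z ∈ S, ∃ s : ℕ → ℕ, StrictMono s ∧ Tendsto (fun n => y (s n)) atTop (𝓝 z) := by
  simp only [hS.cthickening_eq_biUnion_closedBall (hd _), mem_iUnion₂] at hy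
  choose x hxS hyx using hy
  obtain ⟨z, hz, s, hs, hxz⟩ := hS.tendsto_subseq hxS
  refine ⟨z, hz, s, hs, tendsto_iff_dist_tendsto_zero.2 ?_⟩
  have hsum : Tendsto (fun n => d (s n) + dist (x (s n)) z) atTop (𝓝 0) := by
    simpa using (hlim.comp hs.tendsto_atTop).add (tendsto_iff_dist_tendsto_zero.1 hxz)
  refine squeeze_zero (fun _ => dist_nonneg) (fun n => ?_) hsum
  exact (dist_triangle _ (x (s n)) z).trans (by gcongr; exact hyx (s n))

lemma eventually_le_of_relaxedLimsup_le (hS : IsCompact S) (hd : ∀ n, 0 ≤ d n)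
    (hlim : Tendsto d atTop (𝓝 0)) {w : ℕ → X → ℝ} {M : ℝ}
    (hM : ∀ n, ∀ y ∈ Metric.cthickening (d n) S, w n y ≤ M) {g : X → ℝ} (hg : Continuous g)
    (hle : ∀ z ∈ S, relaxedLimsup (fun n => Metric.cthickening (d n) S) w z ≤ g z)
    {ε : ℝ} (hε : 0 < ε) :
    ∀ᶠ n in atTop, ∀ y ∈ Metric.cthickening (d n) S, w n y ≤ g y + ε := by
  by_contra hcon
  obtain ⟨e, he, hbad⟩ := extraction_of_frequently_atTop (not_eventually.1 hcon)
  push Not at hbad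
  choose y hyK hwy using hbad
  obtain ⟨z, hz, s, hs, hyz⟩ := exists_subseq_tendsto_of_mem_cthickening hS (fun n => hd (e n))
    (hlim.comp he.tendsto_atTop) hyK
  have hgz : ∀ᶠ n in atTop, g z - ε / 2 < g (y (s n)) :=
    ((hg.tendsto z).comp hyz).eventually_const_lt (by linarith)
  have hlow := le_relaxedLimsup_of_tendsto hM (he.tendsto_atTop.comp hs.tendsto_atTop) hyz
    (fun n => hyK (s n)) (hgz.mono fun n hn => show g z + ε / 2 ≤ w (e (s n)) (y (s n)) by
      linarith [hwy (s n)])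
  linarith [hle z hz]

end Thickening

section DirichletLimit

variable {N : ℕ} {O Ω : Set (Space N)} {F : Operator N} {α : ℝ}

lemma IsDegenerateElliptic.shiftedOperator (hF : IsDegenerateElliptic O F) (l α : ℝ) :
    IsDegenerateElliptic O (shiftedOperator F l α) := fun x hx r p X Y hX hY => by
  simpa only [DegenerateMP.shiftedOperator, sub_sub_sub_cancel_right] using hF x hx r p X Y hX hY

lemma IsPosHomogeneous.operator_zero (hF : IsPosHomogeneous O F α) (hα : 0 < α) {x : Space N}
    (hx : x ∈ O) : F x 0 0 0 = 0 := by
  simpa [Real.zero_rpow hα.ne'] using hF x hx 0 0 0 Matrix.isSymm_zero 0 le_rfl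

lemma IsPosHomogeneous.operator_nonpos_of_isLocalMax (hF : IsPosHomogeneous O F α) (hα : 0 < α)
    (hF1 : IsDegenerateElliptic O F) {u φ : Space N → ℝ} {ξ : Space N} (hξ : ξ ∈ O)
    (hφ : ContDiff ℝ 2 φ) (hu : ∀ᶠ x in 𝓝 ξ, 0 ≤ u x) (huξ : u ξ = 0)
    (hmax : IsLocalMax (fun x => u x - φ x) ξ) : F ξ (u ξ) (gradient φ ξ) (hessian φ ξ) ≤ 0 := by
  refine hF1.nonpos_of_isLocalMin hξ hφ (contDiff_const (c := (0 : ℝ))) ?_ ?_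
  · filter_upwards [hmax, hu] with x hx hux
    linarith
  · rw [gradient_fun_const, hessian_const, huξ, hF.operator_zero hα hξ]

variable {l d : ℕ → ℝ} {v : ℕ → Space N → ℝ}

lemma operator_nonpos_of_relaxedLimsup_pos (hα : 0 < α) (hF : IsContinuousOperator O F)
    (hΩ : IsCompact (closure Ω)) (hl : ∀ n, 0 ≤ l n) (hl0 : Tendsto l atTop (𝓝 0))
    (hd : ∀ n, 0 ≤ d n) (hd0 : Tendsto d atTop (𝓝 0))
    (hO : ∀ n, Metric.cthickening (d n) (closure Ω) ⊆ O)
    (hv : ∀ n, IsObstacleSubsolution (shiftedOperator F (l n) α)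
      (Metric.cthickening (d n) (closure Ω)) (l n) 1 (v n))
    {φ : Space N → ℝ} (hφ : ContDiff ℝ 2 φ) {ξ : Space N} (hξ : ξ ∈ closure Ω) {L : ℝ}
    (hL : relaxedLimsup (fun n => Metric.cthickening (d n) (closure Ω)) v ξ = L) (hLpos : 0 < L)
    (hmax : IsMaxOn (fun x => relaxedLimsup (fun n => Metric.cthickening (d n) (closure Ω)) v x
      - φ x) (closure Ω) ξ) : F ξ L (gradient φ ξ) (hessian φ ξ) ≤ 0 := by
  have hm : ∀ n, ∀ y ∈ Metric.cthickening (d n) (closure Ω), 0 ≤ v n y := fun n y hy =>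
    (hl n).trans ((hv n).ge y hy)
  have hM : ∀ n, ∀ y ∈ Metric.cthickening (d n) (closure Ω), v n y ≤ 1 := fun n => (hv n).le
  have hξK : ∀ n, ξ ∈ Metric.cthickening (d n) (closure Ω) := fun n =>
    Metric.self_subset_cthickening _ hξ
  obtain ⟨i, x, hi, hxξ, hxK, hlim⟩ := exists_seq_tendsto_relaxedLimsup hm hM hξK
  rw [hL] at hlim
  have hup : ∀ ε : ℝ, 0 < ε → ∀ᶠ n in atTop, ∀ y ∈ Metric.cthickening (d n) (closure Ω),
      v n y ≤ φ y - φ ξ + L + ε := fun ε hε =>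
    eventually_le_of_relaxedLimsup_le hΩ hd hd0 hM (g := fun y => φ y - φ ξ + L)
      (by have := hφ.continuous; fun_prop)
      (fun z hz => by have := hmax hz; simp only [mem_ofPred_eq, hL] at this; linarith) hε
  refine hF.nonpos_of_asymptotic_test hφ (hO 0 (hξK 0)) (fun n => hΩ.cthickening)
    (fun n => hO (i n)) (fun n => (hv (i n)).usc) hxK hxξ hlim
    (fun ε hε => hi.eventually (hup ε hε)) (hl0.comp hi) hLpos (hl0.comp hi)
    fun n χ hχ y hy hmaxy hly => ?_
  have htest := (hv (i n)).test χ hχ y hy hmaxy hly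
  have hpow : l (i n) * v (i n) y ^ α ≤ l (i n) :=
    mul_le_of_le_one_right (hl _) (Real.rpow_le_one (hm _ y hy) (hM _ y hy) hα.le)
  simp only [shiftedOperator, Function.comp_apply] at htest ⊢
  linarith

theorem isDirichletSubsolution_relaxedLimsup (hα : 0 < α) (hF : IsContinuousOperator O F)
    (hF1 : IsDegenerateElliptic O F) (hF2 : IsPosHomogeneous O F α) (hΩo : IsOpen Ω)
    (hΩ : IsCompact (closure Ω)) (hl : ∀ n, 0 ≤ l n) (hl0 : Tendsto l atTop (𝓝 0))
    (hd : ∀ n, 0 ≤ d n) (hd0 : Tendsto d atTop (𝓝 0))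
    (hO : ∀ n, Metric.cthickening (d n) (closure Ω) ⊆ O)
    (hv : ∀ n, IsObstacleSubsolution (shiftedOperator F (l n) α)
      (Metric.cthickening (d n) (closure Ω)) (l n) 1 (v n)) :
    IsDirichletSubsolution F Ω
      (relaxedLimsup (fun n => Metric.cthickening (d n) (closure Ω)) v) := by
  have hm : ∀ n, ∀ y ∈ Metric.cthickening (d n) (closure Ω), 0 ≤ v n y := fun n y hy =>
    (hl n).trans ((hv n).ge y hy)
  set u := relaxedLimsup (fun n => Metric.cthickening (d n) (closure Ω)) v
  have hu0 : ∀ x ∈ closure Ω, 0 ≤ u x := fun x hx =>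
    le_relaxedLimsup hm (fun n => (hv n).le) fun n => Metric.self_subset_cthickening _ hx
  intro φ hφ ξ hξ hmax
  rcases (hu0 ξ hξ).eq_or_lt with hzero | hpos
  · refine ⟨fun hξΩ => ?_, fun _ => min_le_of_left_le hzero.ge⟩
    have hΩξ : Ω ∈ 𝓝 ξ := hΩo.mem_nhds hξΩ
    exact hF2.operator_nonpos_of_isLocalMax hα hF1 (hO 0 (Metric.self_subset_cthickening _ hξ))
      hφ (mem_of_superset hΩξ fun x hx => hu0 x (subset_closure hx)) hzero.symm
      (hmax.isLocalMax (mem_of_superset hΩξ subset_closure))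
  · have hξu := operator_nonpos_of_relaxedLimsup_pos hα hF hΩ hl hl0 hd hd0 hO hv hφ hξ rfl hpos
      hmax
    exact ⟨fun _ => hξu, fun _ => min_le_of_right_le hξu⟩

end DirichletLimit

section PrincipalEigenvalue

variable {N : ℕ} {O Ω : Set (Space N)} {F : Operator N} {α l d : ℝ} {v : Space N → ℝ}

lemma coe_le_mu1_of_lt_one (hα : 0 < α) (hF : IsContinuousOperator O F)
    (hF1 : IsDegenerateElliptic O F) (hl : 0 < l) (hd : 0 < d)
    (hO : Metric.cthickening d (closure Ω) ⊆ O)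
    (hv : IsObstacleSubsolution (shiftedOperator F l α) (Metric.cthickening d (closure Ω)) l 1 v)
    (hgreatest : ∀ w, IsObstacleSubsolution (shiftedOperator F l α)
      (Metric.cthickening d (closure Ω)) l 1 w → ∀ x ∈ Metric.cthickening d (closure Ω), w x ≤ v x)
    (hlt : ∀ x ∈ Metric.cthickening d (closure Ω), v x < 1) : (l : EReal) ≤ mu1 O F α Ω := by
  have hU : IsOpen (Metric.thickening d (closure Ω)) := Metric.isOpen_thickening
  have hUK := Metric.thickening_subset_cthickening d (closure Ω)
  have hge : ∀ x ∈ Metric.thickening d (closure Ω), l ≤ v x := fun x hx => hv.ge x (hUK hx)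
  have hle : ∀ x ∈ Metric.thickening d (closure Ω), v x ≤ 1 := fun x hx => hv.le x (hUK hx)
  exact le_sSup ⟨l, rfl, _, hU, Metric.self_subset_thickening hd _, hUK.trans hO, lscEnvelope v,
    lowerSemicontinuousOn_lscEnvelope hU hge hle,
    fun x hx => hl.trans_le (le_lscEnvelope hU hle hx ((hU.eventually_mem hx).mono hge)),
    isSupersolution_lscEnvelope (hF.shiftedOperator l hα) (hF1.shiftedOperator l α) hO hU hUK hv
      hgreatest fun x hx => hlt x (hUK hx)⟩

lemma exists_isObstacleSubsolution_eq_one (hα : 0 < α) (hF : IsContinuousOperator O F)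
    (hF1 : IsDegenerateElliptic O F) (hΩ : IsCompact (closure Ω)) (hl : 0 < l) (hl1 : l ≤ 1)
    (hd : 0 < d) (hO : Metric.cthickening d (closure Ω) ⊆ O) (hmu : mu1 O F α Ω < l) :
    ∃ v, IsObstacleSubsolution (shiftedOperator F l α) (Metric.cthickening d (closure Ω)) l 1 v ∧
      ∃ ξ ∈ Metric.cthickening d (closure Ω), v ξ = 1 := by
  obtain ⟨v, hv, hgreatest⟩ := exists_greatest_isObstacleSubsolution (hF.shiftedOperator l hα)
    hΩ.cthickening hO hl1
  refine ⟨v, hv, ?_⟩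
  by_contra! hne
  exact hmu.not_ge <| coe_le_mu1_of_lt_one hα hF hF1 hl hd hO hv hgreatest fun x hx =>
    (hv.le x hx).lt_of_ne (hne x hx)

theorem mu1_pos_of_maximumPrinciple (hα : 0 < α) (hF : IsContinuousOperator O F)
    (hF1 : IsDegenerateElliptic O F) (hF2 : IsPosHomogeneous O F α) (hO : IsOpen O)
    (hΩo : IsOpen Ω) (hΩ : IsCompact (closure Ω)) (hΩO : closure Ω ⊆ O)
    (hMP : MaximumPrinciple F Ω) : 0 < mu1 O F α Ω := by
  by_contra! hmu
  obtain ⟨ρ, hρ, hρO⟩ := hΩ.exists_cthickening_subset_open hO hΩO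
  set l : ℕ → ℝ := fun n => 1 / ((n : ℝ) + 1)
  have hl : ∀ n, 0 < l n := fun n => Nat.one_div_pos_of_nat
  have hl1 : ∀ n, l n ≤ 1 := fun n => by simpa [l] using Nat.one_div_le_one_div (α := ℝ) n.zero_le
  have hl0 : Tendsto l atTop (𝓝 0) := tendsto_one_div_add_atTop_nhds_zero_nat
  have hd : ∀ n, 0 < ρ * l n := fun n => mul_pos hρ (hl n)
  have hd0 : Tendsto (fun n => ρ * l n) atTop (𝓝 0) := by simpa using hl0.const_mul ρ
  have hKO : ∀ n, Metric.cthickening (ρ * l n) (closure Ω) ⊆ O := fun n =>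
    (Metric.cthickening_mono (mul_le_of_le_one_right hρ.le (hl1 n)) _).trans hρO
  choose v hv ξ hξK hξ using fun n => exists_isObstacleSubsolution_eq_one hα hF hF1 hΩ (hl n)
    (hl1 n) (hd n) (hKO n) (hmu.trans_lt (EReal.coe_pos.2 (hl n)))
  have hm : ∀ n, ∀ y ∈ Metric.cthickening (ρ * l n) (closure Ω), 0 ≤ v n y := fun n y hy =>
    (hl n).le.trans ((hv n).ge y hy)
  obtain ⟨z, hz, s, hs, hlim⟩ := exists_subseq_tendsto_of_mem_cthickening hΩ (fun n => (hd n).le)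
    hd0 hξK
  have hone : 1 ≤ relaxedLimsup (fun n => Metric.cthickening (ρ * l n) (closure Ω)) v z :=
    le_relaxedLimsup_of_tendsto (fun n => (hv n).le) hs.tendsto_atTop hlim (fun n => hξK (s n))
      (.of_forall fun n => (hξ (s n)).ge)
  have hzero := hMP _ (upperSemicontinuousOn_relaxedLimsup hm (fun n => (hv n).le)
    fun n => Metric.self_subset_cthickening _) (isDirichletSubsolution_relaxedLimsup hα hF hF1 hF2
      hΩo hΩ (fun n => (hl n).le) hl0 (fun n => (hd n).le) hd0 hKO hv) z hz
  linarith

end PrincipalEigenvalue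

end DegenerateMP

open DegenerateMP in
theorem theorem1p1_general {N : ℕ} {O Ω : Set (Space N)} {F : Operator N} {α : ℝ} (hO : IsOpen O)
    (hΩ_open : IsOpen Ω) (hΩ_bdd : Bornology.IsBounded Ω) (hΩO : closure Ω ⊆ O) (hα : 0 < α)
    (hF : IsContinuousOperator O F) (hF1 : IsDegenerateElliptic O F)
    (hF2 : IsPosHomogeneous O F α) (hF3 : IsContinuousInValueUniformly O F)
    (hF4 : StructureCondition O F) : MaximumPrinciple F Ω ↔ 0 < mu1 O F α Ω := by
  have hΩ := hΩ_bdd.isCompact_closure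
  refine ⟨mu1_pos_of_maximumPrinciple hα hF hF1 hF2 hO hΩ_open hΩ hΩO, fun hmu => ?_⟩
  obtain ⟨_, ⟨l, rfl, Ω', hΩ', hΩΩ', hΩ'O, φ, hφ, hpos, hsup⟩, hl⟩ := lt_sSup_iff.1 hmu
  exact maximumPrinciple_of_isSupersolution hα hF hF2 hF3 hF4 (EReal.coe_pos.1 hl) hΩ hΩ' hΩΩ'
    hΩ'O hφ hpos hsup

theorem theorem1p1 {N : ℕ} (O Ω : Set (DegenerateMP.Space N))
    (hO : IsOpen O) (hΩ_open : IsOpen Ω) (hΩ_conn : IsConnected Ω)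
    (hΩ_bdd : Bornology.IsBounded Ω) (hΩO : closure Ω ⊆ O)
    (F : DegenerateMP.Operator N) (α : ℝ) (hα : 0 < α)
    (hF : DegenerateMP.IsContinuousOperator O F)
    (hF1 : DegenerateMP.IsDegenerateElliptic O F)
    (hF2 : DegenerateMP.IsPosHomogeneous O F α)
    (hF3 : DegenerateMP.IsContinuousInValueUniformly O F)
    (hF4 : DegenerateMP.StructureCondition O F) :
    DegenerateMP.MaximumPrinciple F Ω ↔ 0 < DegenerateMP.mu1 O F α Ω :=
  theorem1p1_general hO hΩ_open hΩ_bdd hΩO hα hF hF1 hF2 hF3 hF4
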